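/- Let $G=\mathrm{SL}(2,\mathbb R)$, let $H=\{\operatorname{diag}(t,t^{-1}) : t\in\mathbb R^\times\}$, and put $$k_\theta=\begin{pmatrix}\cos\theta&\sin\theta\\-\sin\theta&\cos\theta\end{pmatrix},\qquad \overline n_x=\begin{pmatrix}1&0\\x&1\end{pmatrix}.$$ Equip $G/H$ with the $G$-invariant measure $d(gH)=\tfrac12\,dy\,d\theta$ in the coordinates $(\theta,y)\in[0,\pi)\times\mathbb R$, $gH=k_\theta\overline n_yH$. For $\varepsilon\in\{0,1\}$ and $\lambda\in i\mathbb R$ let $\mathrm{Ind}_H^G(\varepsilon\otimes e^\lambda)$ be the space of (classes of) measurable functions $f:G\to\mathbb C$ with $$f\big(g\operatorname{diag}(t,t^{-1})\big)=\operatorname{sgn}(t)^{\varepsilon}|t|^{-\lambda}f(g)\quad (g\in G,\ t\in\mathbb R^\times),\qquad \int_{G/H}|f(g)|^2\,d(gH)<\infty,$$ functions that agree almost everywhere being identified, with its $L^2(G/H)$ inner product and the left regular action $(\tau(g)f)(x)=f(g^{-1}x)$ of $G$. For $z\in i\mathbb R$ let $u_z$ be the distribution on $\mathbb R$ $$\langle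 u_z,\varphi\rangle=\lim_{w\to z,\ \mathrm{Re}\,w>0}\ \frac{1}{\sqrt\pi\,2^{w/4}}\,\frac{\Gamma\left(\frac{2-w}{4}\right)}{\Gamma\left(\frac w4\right)}\int_{\mathbb R}|x|^{\frac w2-1}\varphi(x)\,dx,\qquad \varphi\in C_c^\infty(\mathbb R),$$ that is, the analytic continuation of the normalized function $|x|^{w/2-1}$ to $w=z$ (in particular $u_0=\delta$). **Theorem.** Let $\varepsilon\in\{0,1\}$ and $\nu,\lambda\in i\mathbb R$. The map $$T_\lambda^\nu f(g)=\frac{1}{\sqrt\pi\,2^{\frac{\lambda-\nu}4}}\,\frac{\Gamma\left(\frac{2+\nu-\lambda}4\right)}{\Gamma\left(\frac{\lambda-\nu}4\right)}\int_{\mathbb R}|x|^{\frac{\lambda-\nu}2-1}f(g\overline n_x)\,dx,$$ where the normalized integral is understood in the sense of the distribution $u_{\lambda-\nu}$, defines a unitary isomorphism $$T_\lambda^\nu:\mathrm{Ind}_H^G(\varepsilon\otimes e^\lambda)\to\mathrm{Ind}_H^G(\varepsilon\otimes e^\nu)$$ that intertwines the left regular actions of $G$. Precisely, there is a surjective linear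 isometry $T_\lambda^\nu$ between these spaces, commuting with the actions of $G$, such that: 1. for $f\in\mathrm{Ind}_H^G(\varepsilon\otimes e^\lambda)$ and $F\in\mathrm{Ind}_H^G(\varepsilon\otimes e^\nu)$ one has $T_\lambda^\nu f=F$ if and only if, for almost every $gH\in G/H$ (and every representative $g$), the function $y\mapsto F(g\overline n_y)$ is the distributional convolution of $y\mapsto f(g\overline n_y)$ with the even distribution $u_{\lambda-\nu}$, i.e. $\int_{\mathbb R} F(g\overline n_y)\eta(y)\,dy=\int_{\mathbb R} f(g\overline n_y)\,\langle u_{\lambda-\nu},\eta(\cdot+y)\rangle\,dy$ for all $\eta\in C_c^\infty(\mathbb R)$; 2. if $f$ is smooth on $G$ and its support has relatively compact image in $G/H$, then $T_\lambda^\nu f$ is represented by the function $g\mapsto\langle u_{\lambda-\nu},\,x\mapsto f(g\overline n_x)\rangle$. -/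

import Mathlib

open MeasureTheory Filter Topology
open scoped ENNReal ContDiff ComplexConjugate

noncomputable section

namespace SL2

/-- The Lie group `SL(2, ℝ)` with the topology of a subspace of the `2 × 2` matrices. -/
abbrev G : Type := Matrix.SpecialLinearGroup (Fin 2) ℝ

/-- `SL(2, ℝ)` carries its Borel `σ`-algebra. -/
instance instMeasurableSpaceG : MeasurableSpace G := borel G

instance instBorelSpaceG : BorelSpace G := ⟨rfl⟩

/-- The rotation `k_θ = (cos θ, sin θ; -sin θ, cos θ)`. -/
def rot (θ : ℝ) : G :=
  ⟨!![Real.cos θ, Real.sin θ; -Real.sin θ, Real.cos θ], by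
    rw [Matrix.det_fin_two_of]; nlinarith [Real.sin_sq_add_cos_sq θ]⟩

/-- The lower triangular unipotent matrix `n̄_x = (1, 0; x, 1)`. -/
def nbar (x : ℝ) : G :=
  ⟨!![1, 0; x, 1], by rw [Matrix.det_fin_two_of]; ring⟩

/-- The diagonal matrix `diag(e^t, e^{-t})`. -/
def expDiag (t : ℝ) : G :=
  ⟨!![Real.exp t, 0; 0, Real.exp (-t)], by
    rw [Matrix.det_fin_two_of, ← Real.exp_add]; simp⟩

/-- The subgroup `H = M A` of diagonal matrices `diag(t, t⁻¹)`, `t ∈ ℝˣ`. -/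
def diagonalSubgroup : Subgroup G where
  carrier := {g | g 0 1 = 0 ∧ g 1 0 = 0}
  one_mem' := by simp
  mul_mem' := by
    rintro a b ⟨h1, h2⟩ ⟨h3, h4⟩
    simp [Matrix.mul_apply, Fin.sum_univ_two, h1, h2, h3, h4]
  inv_mem' := by
    rintro a ⟨h1, h2⟩
    simp [Matrix.SpecialLinearGroup.coe_inv, Matrix.adjugate_fin_two, h1, h2]

/-- The homogeneous space `G / H` (with the quotient topology and quotient `σ`-algebra). -/
abbrev X : Type := G ⧸ diagonalSubgroup

/-- The imaginary axis `i ℝ ⊆ ℂ`. -/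
abbrev ImaginaryAxis : Type := {z : ℂ // z.re = 0}

/-- `|t|_ε^z = sgn(t)^ε |t|^z`; at `t = h 0 0` it is the value at `h ∈ H` of the character
`ε ⊗ e^z` of `H`. -/
def signedPow (ε : ZMod 2) (z : ℂ) (t : ℝ) : ℂ :=
  ((SignType.sign t : ℝ) : ℂ) ^ ε.val * ((|t| : ℝ) : ℂ) ^ z

/-- The invariant measure `d(xH) = ½ dy dθ` on `G / H`, in the coordinates
`(θ, y) ∈ [0, π) × ℝ`, `xH = k_θ n̄_y H`. -/
def invMeasure : Measure X :=
  Measure.map (fun p : ℝ × ℝ => ((rot p.1 * nbar p.2 : G) : X))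
    ((1 / 2 : ℝ≥0∞) • (volume.restrict (Set.Ico 0 Real.pi)).prod volume)

/-! ### The measure is invariant -/

theorem G_ext {g h : G} (h00 : g 0 0 = h 0 0) (h01 : g 0 1 = h 0 1) (h10 : g 1 0 = h 1 0)
    (h11 : g 1 1 = h 1 1) : g = h := by
  ext i j
  fin_cases i <;> fin_cases j <;> assumption

theorem det_eq (g : G) : g 0 0 * g 1 1 - g 0 1 * g 1 0 = 1 := by
  have := g.det_coe
  rwa [Matrix.det_fin_two] at this

theorem mul_entry (g h : G) (i j : Fin 2) : (g * h) i j = g i 0 * h 0 j + g i 1 * h 1 j := by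
  rw [Matrix.SpecialLinearGroup.coe_mul, Matrix.mul_apply, Fin.sum_univ_two]

theorem continuous_mk {α : Type*} [TopologicalSpace α] {u : α → G}
    (h : ∀ i j, Continuous fun a => u a i j) : Continuous u :=
  Continuous.subtype_mk (continuous_matrix h) _

theorem measurable_mk {α : Type*} [MeasurableSpace α] {u : α → G}
    (h : ∀ i j, Measurable fun a => u a i j) : Measurable u := by
  have hi : Topology.IsInducing (fun g : G => (fun i j => g i j : Fin 2 → Fin 2 → ℝ)) :=
    Topology.IsInducing.subtypeVal
  have e : instMeasurableSpaceG =
      MeasurableSpace.comap (fun g : G => (fun i j => g i j : Fin 2 → Fin 2 → ℝ)) inferInstance := by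
    refine (congrArg (@borel G) hi.eq_induced).trans ?_
    rw [borel_comap, ← BorelSpace.measurable_eq]
  rw [e, measurable_comap_iff]
  exact measurable_pi_lambda _ fun i => measurable_pi_lambda _ fun j => h i j

theorem continuous_rot : Continuous rot := by
  refine continuous_mk fun i j => ?_
  fin_cases i <;> fin_cases j <;> simp [rot] <;> fun_prop

theorem continuous_nbar : Continuous nbar := by
  refine continuous_mk fun i j => ?_
  fin_cases i <;> fin_cases j <;> simp [nbar] <;> fun_prop

@[simp] theorem nbar_00 (x : ℝ) : nbar x 0 0 = 1 := rfl
@[simp] theorem nbar_01 (x : ℝ) : nbar x 0 1 = 0 := rfl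
@[simp] theorem nbar_10 (x : ℝ) : nbar x 1 0 = x := rfl
@[simp] theorem nbar_11 (x : ℝ) : nbar x 1 1 = 1 := rfl

theorem nbar_add (x y : ℝ) : nbar (x + y) = nbar x * nbar y := by
  apply G_ext <;> simp [mul_entry]

/-- The matrix `diag(c, c⁻¹)`, as an element of the group. -/
def dilation (c : ℝ) (hc : c ≠ 0) : G :=
  ⟨!![c, 0; 0, c⁻¹], by rw [Matrix.det_fin_two_of]; field_simp; simp⟩

section
variable (c : ℝ) (hc : c ≠ 0)

@[simp] theorem dilation_00 : dilation c hc 0 0 = c := rfl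
@[simp] theorem dilation_01 : dilation c hc 0 1 = 0 := rfl
@[simp] theorem dilation_10 : dilation c hc 1 0 = 0 := rfl
@[simp] theorem dilation_11 : dilation c hc 1 1 = c⁻¹ := rfl

theorem dilation_mem : dilation c hc ∈ diagonalSubgroup := ⟨rfl, rfl⟩

theorem dilation_mul_nbar (y : ℝ) :
    dilation c hc * nbar y = nbar (c⁻¹ * y * c⁻¹) * dilation c hc := by
  apply G_ext <;> simp [mul_entry, hc]

end

/-- An element of the group with second column `(p.2, p.1)`. -/
def sec (p : ℝ × ℝ) : G :=
  if h : p.1 ^ 2 + p.2 ^ 2 = 0 then 1 else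
    ⟨!![p.1 / (p.1 ^ 2 + p.2 ^ 2), p.2; -p.2 / (p.1 ^ 2 + p.2 ^ 2), p.1], by
      rw [Matrix.det_fin_two_of]; field_simp; ring⟩

theorem sec_01 {p : ℝ × ℝ} (h : p.1 ^ 2 + p.2 ^ 2 ≠ 0) : sec p 0 1 = p.2 := by simp [sec, h]

theorem sec_11 {p : ℝ × ℝ} (h : p.1 ^ 2 + p.2 ^ 2 ≠ 0) : sec p 1 1 = p.1 := by simp [sec, h]

theorem exists_nbar {g h : G} (h1 : g 0 1 = h 0 1) (h2 : g 1 1 = h 1 1) :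
    ∃ c, g = h * nbar c := by
  refine ⟨g 1 0 * h 0 0 - g 0 0 * h 1 0, ?_⟩
  have e1 := det_eq g
  have e2 := det_eq h
  rw [h1, h2] at e1
  apply G_ext <;> simp [mul_entry, h1, h2]
  · linear_combination h 0 0 * e1 - g 0 0 * e2
  · linear_combination h 1 0 * e1 - g 1 0 * e2

theorem measurable_sec : Measurable sec := by
  have hs : MeasurableSet {p : ℝ × ℝ | p.1 ^ 2 + p.2 ^ 2 = 0} :=
    (isClosed_eq (by fun_prop) (by fun_prop)).measurableSet
  refine measurable_mk fun i j => ?_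
  have : (fun p => sec p i j) = fun p : ℝ × ℝ => if p.1 ^ 2 + p.2 ^ 2 = 0 then (1 : G) i j else
      (!![p.1 / (p.1 ^ 2 + p.2 ^ 2), p.2; -p.2 / (p.1 ^ 2 + p.2 ^ 2), p.1] : Matrix _ _ ℝ) i j := by
    funext p
    by_cases h : p.1 ^ 2 + p.2 ^ 2 = 0
    · rw [if_pos h, show sec p = 1 from dif_pos h]
    · rw [if_neg h]
      exact congrArg (fun x : G => x i j) (dif_neg h)
  rw [this]
  refine Measurable.ite hs measurable_const ?_
  fin_cases i <;> fin_cases j <;> simp <;> fun_prop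

/-- The integral over the fibre through the second column. -/
def fib (F : G → ℝ≥0∞) (p : ℝ × ℝ) : ℝ≥0∞ := ∫⁻ y, F (sec p * nbar y)

theorem fib_eq (F : G → ℝ≥0∞) (g : G) :
    fib F (g 1 1, g 0 1) = ∫⁻ y, F (g * nbar y) := by
  have hne : (g 1 1, g 0 1).1 ^ 2 + (g 1 1, g 0 1).2 ^ 2 ≠ 0 := by
    intro h
    have h1 : g 1 1 = 0 := by simp at h; nlinarith [sq_nonneg (g 1 1), sq_nonneg (g 0 1)]
    have h2 : g 0 1 = 0 := by simp at h; nlinarith [sq_nonneg (g 1 1), sq_nonneg (g 0 1)]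
    have := det_eq g
    simp [h1, h2] at this
  obtain ⟨c, hc⟩ := exists_nbar (g := g) (h := sec (g 1 1, g 0 1)) (sec_01 hne).symm
    (sec_11 hne).symm
  have : ∀ y, g * nbar y = sec (g 1 1, g 0 1) * nbar (c + y) := by
    intro y
    conv_lhs => rw [hc]
    rw [nbar_add, mul_assoc]
  simp_rw [this]
  exact (lintegral_add_left_eq_self (fun y => F (sec (g 1 1, g 0 1) * nbar y)) c).symm

theorem measurable_fib {F : G → ℝ≥0∞} (hF : Measurable F) : Measurable (fib F) := by
  unfold fib
  refine Measurable.lintegral_prod_right' (f := fun q : (ℝ × ℝ) × ℝ => F (sec q.1 * nbar q.2)) ?_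
  have h2 : Measurable fun q : G × ℝ => F (q.1 * nbar q.2) :=
    hF.comp (continuous_fst.mul (continuous_nbar.comp continuous_snd)).measurable
  exact h2.comp ((measurable_sec.comp measurable_fst).prodMk measurable_snd)

theorem lintegral_comp_mul {f : ℝ → ℝ≥0∞} (hf : Measurable f) {c : ℝ} (hc : c ≠ 0) :
    ∫⁻ x, f (c * x) = ENNReal.ofReal |c⁻¹| * ∫⁻ x, f x := by
  rw [← lintegral_map hf (measurable_const_mul c), Real.map_volume_mul_left hc,
    lintegral_smul_measure, smul_eq_mul]

theorem sq_ne {p : ℝ × ℝ} (h : p ≠ 0) : p.1 ^ 2 + p.2 ^ 2 ≠ 0 := by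
  intro h0
  apply h
  ext
  · simp; nlinarith [sq_nonneg p.1, sq_nonneg p.2]
  · simp; nlinarith [sq_nonneg p.1, sq_nonneg p.2]

/-- The linear action on second columns, written as `(p.2, p.1)`. -/
def act (g : G) (p : ℝ × ℝ) : ℝ × ℝ :=
  (g 1 1 * p.1 + g 1 0 * p.2, g 0 1 * p.1 + g 0 0 * p.2)

theorem act_inv_act (g : G) (p : ℝ × ℝ) : act g⁻¹ (act g p) = p := by
  have := det_eq g
  ext
  · simp [act, Matrix.SpecialLinearGroup.coe_inv, Matrix.adjugate_fin_two]
    linear_combination p.1 * this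
  · simp [act, Matrix.SpecialLinearGroup.coe_inv, Matrix.adjugate_fin_two]
    linear_combination p.2 * this

theorem act_ne {g : G} {p : ℝ × ℝ} (h : p ≠ 0) : act g p ≠ 0 := by
  intro h0
  apply h
  rw [← act_inv_act g p, h0]
  simp [act]

theorem act_smul (g : G) (c : ℝ) (p : ℝ × ℝ) : act g (c • p) = c • act g p := by
  ext <;> simp [act] <;> ring

theorem continuous_act (g : G) : Continuous (act g) := by
  unfold act; fun_prop

theorem measurePreserving_act (g : G) : MeasurePreserving (act g) volume volume := by
  refine ⟨(continuous_act g).measurable, ?_⟩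
  let M : Matrix (Fin 2) (Fin 2) ℝ := !![g 1 1, g 1 0; g 0 1, g 0 0]
  let T := Matrix.toLin (Module.Basis.finTwoProd ℝ) (Module.Basis.finTwoProd ℝ) M
  have hT : act g = T := by
    funext p
    simp only [T, M, Matrix.toLin_finTwoProd_apply]
    rfl
  have hd : LinearMap.det T = 1 := by
    simp only [T, M, LinearMap.det_toLin, Matrix.det_fin_two_of]
    linear_combination det_eq g
  rw [hT, Measure.map_linearMap_addHaar_eq_smul_addHaar _ (by rw [hd]; norm_num), hd]
  simp

theorem fib_smul {F : G → ℝ≥0∞} (hF : Measurable F)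
    (hH : ∀ g, ∀ h ∈ diagonalSubgroup, F (g * h) = F g) {c : ℝ} (hc : c ≠ 0) {p : ℝ × ℝ}
    (hp : p ≠ 0) : fib F (c • p) = ENNReal.ofReal (c ^ 2)⁻¹ * fib F p := by
  have h1 := sq_ne hp
  have e := fib_eq F (sec p * dilation c⁻¹ (inv_ne_zero hc))
  have e1 : (sec p * dilation c⁻¹ (inv_ne_zero hc)) 1 1 = c * p.1 := by
    rw [mul_entry]; simp [sec_11 h1, mul_comm]
  have e2 : (sec p * dilation c⁻¹ (inv_ne_zero hc)) 0 1 = c * p.2 := by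
    rw [mul_entry]; simp [sec_01 h1, mul_comm]
  rw [e1, e2] at e
  have e3 : c • p = (c * p.1, c * p.2) := rfl
  rw [e3, e]
  have e4 : ∀ y, F (sec p * dilation c⁻¹ (inv_ne_zero hc) * nbar y)
      = F (sec p * nbar (c ^ 2 * y)) := by
    intro y
    rw [mul_assoc, dilation_mul_nbar, ← mul_assoc, hH _ _ (dilation_mem _ _), inv_inv]
    congr 3
    ring
  simp_rw [e4]
  have hm : Measurable fun y => F (sec p * nbar y) :=
    hF.comp (continuous_const.mul continuous_nbar).measurable
  rw [lintegral_comp_mul hm (pow_ne_zero 2 hc), abs_of_nonneg (by positivity)]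
  rfl

theorem fib_act (F : G → ℝ≥0∞) (g : G) {p : ℝ × ℝ} (hp : p ≠ 0) :
    fib (fun x => F (g * x)) p = fib F (act g p) := by
  have h1 := sq_ne hp
  have e := fib_eq F (g * sec p)
  rw [mul_entry, mul_entry, sec_01 h1, sec_11 h1] at e
  have e2 : act g p = (g 1 0 * p.2 + g 1 1 * p.1, g 0 0 * p.2 + g 0 1 * p.1) := by
    ext <;> simp [act] <;> ring
  rw [e2, e]
  simp only [fib, mul_assoc]

/-- A weight on the positive half-line, supported in `[1, 2]`. -/
def weight (r : ℝ) : ℝ≥0∞ := (Set.Icc (1 : ℝ) 2).indicator (fun _ => 1) r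

theorem measurable_weight : Measurable weight := measurable_const.indicator measurableSet_Icc

/-- The integral of the weight against `dr / r`. -/
def weightInt : ℝ≥0∞ := ∫⁻ r in Set.Ioi (0 : ℝ), ENNReal.ofReal r⁻¹ * weight r

theorem weightInt_eq : weightInt = ∫⁻ r in Set.Icc (1 : ℝ) 2, ENNReal.ofReal r⁻¹ := by
  unfold weightInt
  rw [← lintegral_indicator measurableSet_Ioi, ← lintegral_indicator measurableSet_Icc]
  congr 1
  funext r
  by_cases h : r ∈ Set.Icc (1 : ℝ) 2
  · have h2 : r ∈ Set.Ioi (0 : ℝ) := lt_of_lt_of_le one_pos h.1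
    simp only [weight, Set.indicator_of_mem h, Set.indicator_of_mem h2, mul_one]
  · rw [Set.indicator_of_notMem h]
    refine Set.indicator_apply_eq_zero.2 fun _ => ?_
    rw [weight, Set.indicator_of_notMem h, mul_zero]

theorem weightInt_ne_top : weightInt ≠ ⊤ := by
  rw [weightInt_eq]
  refine ne_top_of_le_ne_top (b := ∫⁻ _ in Set.Icc (1 : ℝ) 2, 1) ?_ ?_
  · simp
  · refine setLIntegral_mono measurable_const fun r hr => ?_
    rw [ENNReal.ofReal_le_one]
    exact inv_le_one_of_one_le₀ hr.1

theorem weightInt_ne_zero : weightInt ≠ 0 := by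
  rw [weightInt_eq]
  have : (∫⁻ _ in Set.Icc (1 : ℝ) 2, ENNReal.ofReal (2 : ℝ)⁻¹) ≤
      ∫⁻ r in Set.Icc (1 : ℝ) 2, ENNReal.ofReal r⁻¹ := by
    refine setLIntegral_mono (by fun_prop) fun r hr => ?_
    refine ENNReal.ofReal_le_ofReal ?_
    exact inv_anti₀ (lt_of_lt_of_le one_pos hr.1) hr.2
  intro h
  rw [h] at this
  norm_num at this

theorem weight_scale {c : ℝ} (hc : 0 < c) :
    ∫⁻ r in Set.Ioi (0 : ℝ), ENNReal.ofReal r⁻¹ * weight (c * r) = weightInt := by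
  unfold weightInt
  rw [← lintegral_indicator measurableSet_Ioi, ← lintegral_indicator measurableSet_Ioi]
  set f : ℝ → ℝ≥0∞ := (Set.Ioi (0 : ℝ)).indicator fun r => ENNReal.ofReal r⁻¹ * weight r with hf
  have hfm : Measurable f := by
    refine Measurable.indicator ?_ measurableSet_Ioi
    exact (by fun_prop : Measurable fun r : ℝ => ENNReal.ofReal r⁻¹).mul measurable_weight
  have h1 := lintegral_comp_mul hfm hc.ne'
  have h2 : ∀ r, (Set.Ioi (0 : ℝ)).indicator (fun r => ENNReal.ofReal r⁻¹ * weight (c * r)) r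
      = ENNReal.ofReal c * f (c * r) := by
    intro r
    by_cases hr : 0 < r
    · rw [Set.indicator_of_mem (show r ∈ Set.Ioi (0 : ℝ) from hr), hf,
        Set.indicator_of_mem (show c * r ∈ Set.Ioi (0 : ℝ) from mul_pos hc hr), ← mul_assoc,
        ← ENNReal.ofReal_mul hc.le]
      congr 2
      field_simp
    · rw [Set.indicator_of_notMem (show r ∉ Set.Ioi (0 : ℝ) from hr), hf,
        Set.indicator_of_notMem, mul_zero]
      intro h
      exact hr (pos_of_mul_pos_right (Set.mem_Ioi.1 h) hc.le)
  simp_rw [h2]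
  have h3 : Measurable fun r => f (c * r) := hfm.comp (measurable_const_mul c)
  rw [lintegral_const_mul _ h3, h1, ← mul_assoc,
    ← ENNReal.ofReal_mul hc.le, abs_of_pos (inv_pos.2 hc), mul_inv_cancel₀ hc.ne']
  simp

theorem cos_sin_ne (θ : ℝ) : ((Real.cos θ, Real.sin θ) : ℝ × ℝ) ≠ 0 := by
  intro h
  have h1 := congrArg Prod.fst h
  have h2 := congrArg Prod.snd h
  simp only [Prod.fst_zero, Prod.snd_zero] at h1 h2
  have := Real.sin_sq_add_cos_sq θ
  simp [h1, h2] at this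

theorem polar_weight {Φ : ℝ × ℝ → ℝ≥0∞} (hΦ : Measurable Φ)
    (hom : ∀ c : ℝ, c ≠ 0 → ∀ p, p ≠ 0 → Φ (c • p) = ENNReal.ofReal (c ^ 2)⁻¹ * Φ p)
    {N : ℝ × ℝ → ℝ} (hN : Measurable N) (hN1 : ∀ c : ℝ, 0 < c → ∀ p, N (c • p) = c * N p)
    (hN2 : ∀ p, p ≠ 0 → 0 < N p) :
    ∫⁻ p, Φ p * weight (N p) =
      weightInt * ∫⁻ θ in Set.Ioo (-Real.pi) Real.pi, Φ (Real.cos θ, Real.sin θ) := by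
  rw [← lintegral_comp_polarCoord_symm]
  have e1 : ∀ q ∈ polarCoord.target, ENNReal.ofReal q.1 • (Φ (polarCoord.symm q) *
      weight (N (polarCoord.symm q))) = (ENNReal.ofReal q.1⁻¹ *
        weight (N (Real.cos q.2, Real.sin q.2) * q.1)) * Φ (Real.cos q.2, Real.sin q.2) := by
    intro q hq
    have hr : 0 < q.1 := hq.1
    have e : polarCoord.symm q = q.1 • ((Real.cos q.2, Real.sin q.2) : ℝ × ℝ) := by
      rw [polarCoord_symm_apply]; rfl
    rw [e, hom _ hr.ne' _ (cos_sin_ne _), hN1 _ hr, smul_eq_mul, mul_comm q.1 (N _)]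
    have : ENNReal.ofReal q.1⁻¹ = ENNReal.ofReal q.1 * ENNReal.ofReal (q.1 ^ 2)⁻¹ := by
      rw [← ENNReal.ofReal_mul hr.le]
      congr 1
      field_simp
    rw [this]
    ring
  rw [setLIntegral_congr_fun polarCoord.open_target.measurableSet e1]
  have hcs : Measurable fun θ : ℝ => ((Real.cos θ, Real.sin θ) : ℝ × ℝ) := by fun_prop
  have hΦ' : Measurable fun θ => Φ (Real.cos θ, Real.sin θ) := hΦ.comp hcs
  have hN' : Measurable fun θ => N (Real.cos θ, Real.sin θ) := hN.comp hcs
  have hm : Measurable fun q : ℝ × ℝ => (ENNReal.ofReal q.1⁻¹ *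
        weight (N (Real.cos q.2, Real.sin q.2) * q.1)) * Φ (Real.cos q.2, Real.sin q.2) := by
    refine Measurable.mul (Measurable.mul (by fun_prop) (measurable_weight.comp ?_)) ?_
    · exact (hN'.comp measurable_snd).mul measurable_fst
    · exact hΦ'.comp measurable_snd
  rw [polarCoord_target, Measure.volume_eq_prod, ← Measure.prod_restrict,
    lintegral_prod_symm' _ hm, ← lintegral_const_mul _ hΦ']
  congr 1
  funext θ
  dsimp only
  rw [lintegral_mul_const, weight_scale (hN2 _ (cos_sin_ne θ))]
  exact (by fun_prop : Measurable fun r : ℝ => ENNReal.ofReal r⁻¹).mul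
    (measurable_weight.comp (measurable_const_mul _))

theorem circle_invariant {F : G → ℝ≥0∞} (hF : Measurable F)
    (hH : ∀ g, ∀ h ∈ diagonalSubgroup, F (g * h) = F g) (g : G) :
    ∫⁻ θ in Set.Ioo (-Real.pi) Real.pi, fib (fun x => F (g * x)) (Real.cos θ, Real.sin θ) =
      ∫⁻ θ in Set.Ioo (-Real.pi) Real.pi, fib F (Real.cos θ, Real.sin θ) := by
  let N : ℝ × ℝ → ℝ := fun p => Real.sqrt (p.1 ^ 2 + p.2 ^ 2)
  have hN : Measurable N := by fun_prop
  have hN1 : ∀ c : ℝ, 0 < c → ∀ p, N (c • p) = c * N p := by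
    intro c hc p
    have : (c • p).1 ^ 2 + (c • p).2 ^ 2 = c ^ 2 * (p.1 ^ 2 + p.2 ^ 2) := by
      simp; ring
    simp only [N]
    rw [this, Real.sqrt_mul (sq_nonneg c), Real.sqrt_sq hc.le]
  have hN2 : ∀ p, p ≠ 0 → 0 < N p := fun p hp =>
    Real.sqrt_pos.2 (lt_of_le_of_ne (by positivity) (sq_ne hp).symm)
  have hL : Measurable fun x : G => g * x := (continuous_const.mul continuous_id).measurable
  have hFg : Measurable fun x => F (g * x) := hF.comp hL
  have hHg : ∀ x, ∀ h ∈ diagonalSubgroup, F (g * (x * h)) = F (g * x) := by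
    intro x h hh; rw [← mul_assoc, hH _ _ hh]
  have A := polar_weight (measurable_fib hFg) (fun c hc p hp => fib_smul hFg hHg hc hp) hN hN1 hN2
  have B := polar_weight (measurable_fib hF) (fun c hc p hp => fib_smul hF hH hc hp)
    (N := fun p => N (act g⁻¹ p)) (hN.comp (continuous_act _).measurable)
    (fun c hc p => by rw [act_smul, hN1 c hc]) (fun p hp => hN2 _ (act_ne hp))
  have C : ∫⁻ p, fib (fun x => F (g * x)) p * weight (N p) =
      ∫⁻ p, fib F p * weight (N (act g⁻¹ p)) := by
    have hm : Measurable fun p => fib F p * weight (N (act g⁻¹ p)) := (measurable_fib hF).mul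
      (measurable_weight.comp (hN.comp (continuous_act _).measurable))
    rw [← (measurePreserving_act g).lintegral_comp hm]
    refine lintegral_congr_ae ?_
    have h0 : ∀ᵐ p : ℝ × ℝ, p ≠ 0 := by
      rw [ae_iff]
      simp
    filter_upwards [h0] with p hp
    simp only [act_inv_act]
    rw [fib_act F g hp]
  rw [A, B] at C
  exact (ENNReal.mul_right_inj weightInt_ne_zero weightInt_ne_top).1 C

theorem circle_half {F : G → ℝ≥0∞} (hF : Measurable F)
    (hH : ∀ g, ∀ h ∈ diagonalSubgroup, F (g * h) = F g) :
    ∫⁻ θ in Set.Ioo (-Real.pi) Real.pi, fib F (Real.cos θ, Real.sin θ) =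
      2 * ∫⁻ θ in Set.Ico 0 Real.pi, fib F (Real.cos θ, Real.sin θ) := by
  have h1 : Set.Ico (-Real.pi) Real.pi = Set.Ico (-Real.pi) 0 ∪ Set.Ico 0 Real.pi :=
    (Set.Ico_union_Ico_eq_Ico (by linarith [Real.pi_pos]) Real.pi_pos.le).symm
  rw [setLIntegral_congr Ioo_ae_eq_Ico, h1, lintegral_union measurableSet_Ico, two_mul]
  · congr 1
    rw [← lintegral_indicator measurableSet_Ico, ← lintegral_indicator measurableSet_Ico,
      ← lintegral_sub_right_eq_self _ Real.pi]
    congr 1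
    funext θ
    have hm : θ - Real.pi ∈ Set.Ico (-Real.pi) 0 ↔ θ ∈ Set.Ico 0 Real.pi := by
      simp only [Set.mem_Ico]
      constructor <;> rintro ⟨a, b⟩ <;> constructor <;> linarith
    by_cases h : θ ∈ Set.Ico 0 Real.pi
    · rw [Set.indicator_of_mem h, Set.indicator_of_mem (hm.2 h), Real.cos_sub_pi, Real.sin_sub_pi]
      have := fib_smul hF hH (c := -1) (by norm_num) (cos_sin_ne θ)
      simpa using this
    · rw [Set.indicator_of_notMem h, Set.indicator_of_notMem (fun h' => h (hm.1 h'))]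
  · rw [Set.disjoint_left]
    rintro x ⟨_, h⟩ ⟨h', _⟩
    linarith

theorem measurable_chart :
    Measurable (fun p : ℝ × ℝ => ((rot p.1 * nbar p.2 : G) : X)) :=
  QuotientGroup.measurable_coe.comp
    ((continuous_rot.comp continuous_fst).mul (continuous_nbar.comp continuous_snd)).measurable

theorem lintegral_invMeasure {φ : X → ℝ≥0∞} (hφ : Measurable φ) :
    ∫⁻ x, φ x ∂invMeasure = (1 / 2) * ∫⁻ θ in Set.Ico 0 Real.pi,
      fib (fun g => φ (g : X)) (Real.cos θ, Real.sin θ) := by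
  unfold invMeasure
  have hm : Measurable fun p : ℝ × ℝ => φ ((rot p.1 * nbar p.2 : G) : X) :=
    hφ.comp measurable_chart
  rw [lintegral_map hφ measurable_chart, lintegral_smul_measure, smul_eq_mul,
    lintegral_prod _ hm.aemeasurable]
  congr 2
  funext θ
  exact (fib_eq (fun g => φ (g : X)) (rot θ)).symm

theorem measurable_smul_X (g : G) : Measurable fun x : X => g • x := by
  rw [QuotientGroup.measurable_from_quotient]
  exact QuotientGroup.measurable_coe.comp (continuous_const.mul continuous_id).measurable

theorem measurePreserving_smul (g : G) :
    MeasurePreserving (fun x : X => g • x) invMeasure invMeasure := by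
  refine ⟨measurable_smul_X g, Measure.ext fun s hs => ?_⟩
  have hm : Measurable (s.indicator (fun _ => (1 : ℝ≥0∞))) := measurable_const.indicator hs
  have h1 : ∀ m : Measure X, m s = ∫⁻ x, s.indicator (fun _ => (1 : ℝ≥0∞)) x ∂m :=
    fun m => (lintegral_indicator_one hs).symm
  have hm' : Measurable fun x : X => s.indicator (fun _ => (1 : ℝ≥0∞)) (g • x) :=
    hm.comp (measurable_smul_X g)
  rw [h1, h1,
    lintegral_map hm (measurable_smul_X g), lintegral_invMeasure hm,
    lintegral_invMeasure hm']
  congr 1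
  have hF : Measurable fun x : G => s.indicator (fun _ => (1 : ℝ≥0∞)) (x : X) :=
    hm.comp QuotientGroup.measurable_coe
  have hH : ∀ x : G, ∀ h ∈ diagonalSubgroup, s.indicator (fun _ => (1 : ℝ≥0∞)) ((x * h : G) : X)
      = s.indicator (fun _ => (1 : ℝ≥0∞)) (x : X) := by
    intro x h hh
    rw [QuotientGroup.mk_mul_of_mem x hh]
  have hL : Measurable fun x : G => g * x := (continuous_const.mul continuous_id).measurable
  have e := circle_invariant hF hH g
  have hFg : Measurable fun x : G => s.indicator (fun _ => (1 : ℝ≥0∞)) ((g * x : G) : X) :=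
    hF.comp hL
  rw [circle_half hF hH, circle_half hFg
    (fun x h hh => by
      rw [← mul_assoc]
      exact hH _ _ hh)] at e
  exact (ENNReal.mul_right_inj (by norm_num) (by norm_num)).1 e

/-! ### The induced representations -/

theorem mem_diag_ne {h : G} (hh : h ∈ diagonalSubgroup) : h 0 0 ≠ 0 := by
  intro h0
  have := det_eq h
  rw [h0, hh.1] at this
  simp at this

theorem norm_signedPow (ε : ZMod 2) (lam : ImaginaryAxis) {t : ℝ} (ht : t ≠ 0) :
    ‖signedPow ε lam t‖ = 1 := by
  unfold signedPow
  rw [norm_mul, norm_pow, Complex.norm_cpow_eq_rpow_re_of_pos (abs_pos.2 ht), lam.2, Real.rpow_zero]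
  rcases lt_or_gt_of_ne ht with h | h <;> simp [h]

/-- `f (g h) = χ(h)⁻¹ f(g)` for all `h ∈ H`, where `χ = ε ⊗ e^λ`. -/
def IsEquivariant (ε : ZMod 2) (lam : ImaginaryAxis) (f : G → ℂ) : Prop :=
  ∀ g, ∀ h ∈ diagonalSubgroup, f (g * h) = (signedPow ε lam (h 0 0))⁻¹ * f g

/-- The measurable functions `f : G → ℂ` with `f (g h) = χ(h)⁻¹ f(g)`, `h ∈ H`, and
`∫_{G/H} |f(g)|² d(gH) < ∞`. Since `|f|` is constant on the cosets of `H`, it does not matter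
that the integrand is evaluated at a chosen representative `x.out` of the coset `x`. -/
def indSubmodule (ε : ZMod 2) (lam : ImaginaryAxis) : Submodule ℂ (G → ℂ) where
  carrier := {f | Measurable f ∧ IsEquivariant ε lam f ∧
    ∫⁻ x : X, ‖f x.out‖ₑ ^ 2 ∂invMeasure < ⊤}
  zero_mem' := ⟨measurable_const, fun g h _ => by simp, by simp⟩
  add_mem' := by
    rintro f f' ⟨h1, h2, h3⟩ ⟨k1, k2, k3⟩
    refine ⟨h1.add k1, fun g h hh => by simp [h2 g h hh, k2 g h hh, mul_add], ?_⟩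
    have hm : Measurable fun x : X => ‖f x.out‖ₑ ^ 2 := by
      rw [QuotientGroup.measurable_from_quotient]
      have : (fun x : X => ‖f x.out‖ₑ ^ 2) ∘ ((↑) : G → X) = fun g => ‖f g‖ₑ ^ 2 := by
        funext g
        obtain ⟨h, hh⟩ := QuotientGroup.mk_out_eq_mul diagonalSubgroup g
        simp only [Function.comp, hh]
        rw [h2 g h h.2, enorm_mul, enorm_inv, ← ofReal_norm (signedPow _ _ _),
          norm_signedPow _ _ (mem_diag_ne h.2)]
        · simp
        · rw [← norm_ne_zero_iff, norm_signedPow _ _ (mem_diag_ne h.2)]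
          exact one_ne_zero
      rw [this]
      fun_prop
    refine lt_of_le_of_lt (b := ∫⁻ x : X, (2 * ‖f x.out‖ₑ ^ 2 + 2 * ‖f' x.out‖ₑ ^ 2) ∂invMeasure)
      (lintegral_mono fun x => ?_) ?_
    · have h4 : ‖(f + f') x.out‖ₑ ≤ ‖f x.out‖ₑ + ‖f' x.out‖ₑ := enorm_add_le _ _
      have h5 := ENNReal.rpow_add_le_mul_rpow_add_rpow ‖f x.out‖ₑ ‖f' x.out‖ₑ
        (p := 2) (by norm_num)
      norm_num at h5
      rw [← mul_add]
      exact (pow_le_pow_left' h4 2).trans h5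
    · rw [lintegral_add_left (hm.const_mul 2), lintegral_const_mul' _ _ (by norm_num),
        lintegral_const_mul' _ _ (by norm_num)]
      exact ENNReal.add_lt_top.2 ⟨ENNReal.mul_lt_top (by norm_num) h3,
        ENNReal.mul_lt_top (by norm_num) k3⟩
  smul_mem' := by
    rintro c f ⟨h1, h2, h3⟩
    refine ⟨h1.const_smul c, fun g h hh => ?_, ?_⟩
    · simp only [Pi.smul_apply, smul_eq_mul, h2 g h hh]
      ring
    · simp only [Pi.smul_apply, smul_eq_mul, enorm_mul, mul_pow]
      rw [lintegral_const_mul' _ _ (by finiteness)]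
      exact ENNReal.mul_lt_top (by finiteness) h3

/-- The space of functions underlying `Ind_H^G(ε ⊗ e^λ)`, before functions that agree almost
everywhere are identified. -/
def IndFun (ε : ZMod 2) (lam : ImaginaryAxis) : Type := indSubmodule ε lam

namespace IndFun

variable {ε : ZMod 2} {lam : ImaginaryAxis}

instance : AddCommGroup (IndFun ε lam) := inferInstanceAs (AddCommGroup (indSubmodule ε lam))

instance : Module ℂ (IndFun ε lam) := inferInstanceAs (Module ℂ (indSubmodule ε lam))

instance : CoeFun (IndFun ε lam) fun _ => G → ℂ := ⟨fun f => f.1⟩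

theorem add_apply (f f' : IndFun ε lam) (g : G) : (f + f') g = f g + f' g := rfl

theorem smul_apply (c : ℂ) (f : IndFun ε lam) (g : G) : (c • f) g = c * f g := rfl

theorem ext' {f f' : IndFun ε lam} (h : ∀ g, f g = f' g) : f = f' := Subtype.ext (funext h)

/-- The function `x ↦ conj (f x) f'(x)` on `G / H`; as `f`, `f'` transform under the same unitary
character of `H`, it does not depend on the representative of the coset `x`. -/
def pairing (f f' : IndFun ε lam) (x : X) : ℂ := conj (f x.out) * f' x.out

theorem pairing_mk (f f' : IndFun ε lam) (g : G) :
    pairing f f' (g : X) = conj (f g) * f' g := by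
  obtain ⟨h, hh⟩ := QuotientGroup.mk_out_eq_mul diagonalSubgroup g
  unfold pairing
  rw [hh, f.2.2.1 g h h.2, f'.2.2.1 g h h.2]
  set z := signedPow ε lam ((h : G) 0 0)
  have hz : conj z⁻¹ * z⁻¹ = 1 := by
    rw [← Complex.normSq_eq_conj_mul_self, Complex.normSq_eq_norm_sq, norm_inv,
      norm_signedPow _ _ (mem_diag_ne h.2)]
    simp
  rw [map_mul]
  linear_combination (conj (f g) * f' g) * hz

theorem measurable_pairing (f f' : IndFun ε lam) : Measurable (pairing f f') := by
  rw [QuotientGroup.measurable_from_quotient]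
  have : pairing f f' ∘ ((↑) : G → X) = fun g => conj (f g) * f' g :=
    funext fun g => pairing_mk f f' g
  rw [this]
  exact (Complex.continuous_conj.measurable.comp f.2.1).mul f'.2.1

theorem integrable_pairing (f f' : IndFun ε lam) : Integrable (pairing f f') invMeasure := by
  have hself : ∀ k : IndFun ε lam, Integrable (pairing k k) invMeasure := by
    intro k
    refine ⟨(measurable_pairing k k).aestronglyMeasurable, ?_⟩
    refine lt_of_le_of_lt (le_of_eq (lintegral_congr fun x => ?_)) k.2.2.2
    rw [pairing, enorm_mul, RCLike.enorm_conj, sq]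
  refine ((hself f).norm.add (hself f').norm).mono'
    (measurable_pairing f f').aestronglyMeasurable (Eventually.of_forall fun x => ?_)
  simp only [pairing, Pi.add_apply, norm_mul, RCLike.norm_conj]
  nlinarith [sq_nonneg (‖f x.out‖ - ‖f' x.out‖), norm_nonneg (f x.out), norm_nonneg (f' x.out)]

/-- The positive semidefinite Hermitian form `⟨f, f'⟩ = ∫_{G/H} conj (f(g)) f'(g) d(gH)`. -/
abbrev core : PreInnerProductSpace.Core ℂ (IndFun ε lam) where
  inner f f' := ∫ x, pairing f f' x ∂invMeasure
  conj_inner_symm f f' := by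
    change conj (∫ x, pairing f' f x ∂invMeasure) = ∫ x, pairing f f' x ∂invMeasure
    rw [← integral_conj]
    congr 1
    funext x
    simp [pairing, mul_comm]
  re_inner_nonneg f := by
    change 0 ≤ (∫ x, pairing f f x ∂invMeasure).re
    have : ∀ x, pairing f f x = ((‖f x.out‖ ^ 2 : ℝ) : ℂ) := by
      intro x
      rw [pairing, ← Complex.normSq_eq_conj_mul_self, Complex.normSq_eq_norm_sq]
    simp_rw [this]
    rw [integral_complex_ofReal, Complex.ofReal_re]
    exact integral_nonneg fun x => sq_nonneg _
  add_left f f' k := by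
    change ∫ x, pairing (f + f') k x ∂invMeasure = ∫ x, pairing f k x ∂invMeasure +
      ∫ x, pairing f' k x ∂invMeasure
    rw [← integral_add (integrable_pairing f k) (integrable_pairing f' k)]
    congr 1
    funext x
    simp [pairing, add_apply, add_mul]
  smul_left f k c := by
    change ∫ x, pairing (c • f) k x ∂invMeasure = conj c * ∫ x, pairing f k x ∂invMeasure
    rw [← integral_const_mul]
    congr 1
    funext x
    simp [pairing, smul_apply, mul_assoc]

instance : SeminormedAddCommGroup (IndFun ε lam) :=
  @InnerProductSpace.Core.toSeminormedAddCommGroup ℂ _ _ _ _ core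

instance : InnerProductSpace ℂ (IndFun ε lam) := InnerProductSpace.ofCore core

theorem inner_eq (f f' : IndFun ε lam) :
    inner ℂ f f' = ∫ x, pairing f f' x ∂invMeasure := rfl

end IndFun

/-- The Hilbert space `Ind_H^G(ε ⊗ e^λ)`: the quotient of the space of functions `IndFun` by the
functions of norm zero. -/
abbrev Ind (ε : ZMod 2) (lam : ImaginaryAxis) : Type := SeparationQuotient (IndFun ε lam)

section leftRegular

variable {ε : ZMod 2} {lam : ImaginaryAxis}

theorem leftTranslate_mem (g : G) (f : IndFun ε lam) :
    (fun x => f (g⁻¹ * x)) ∈ indSubmodule ε lam := by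
  have h1 : Measurable fun x => f (g⁻¹ * x) :=
    f.2.1.comp (continuous_const.mul continuous_id : Continuous fun x : G => g⁻¹ * x).measurable
  have h2 : IsEquivariant ε lam fun x => f (g⁻¹ * x) := by
    intro x h hh
    simp only [← mul_assoc]
    exact f.2.2.1 _ _ hh
  refine ⟨h1, h2, ?_⟩
  have key : ∀ x : X, ‖f (g⁻¹ * x.out)‖ₑ ^ 2 = ‖IndFun.pairing f f (g⁻¹ • x)‖ₑ := by
    intro x
    have : g⁻¹ • x = ((g⁻¹ * x.out : G) : X) := by
      conv_lhs => rw [← QuotientGroup.out_eq' x]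
      rfl
    rw [this, IndFun.pairing_mk, enorm_mul, RCLike.enorm_conj, sq]
  simp_rw [key]
  rw [(measurePreserving_smul g⁻¹).lintegral_comp (IndFun.measurable_pairing f f).enorm]
  exact (IndFun.integrable_pairing f f).2

/-- The left translation `f ↦ f (g⁻¹ ·)` on functions. -/
def leftTranslate (g : G) : IndFun ε lam →ₗ[ℂ] IndFun ε lam where
  toFun f := ⟨fun x => f (g⁻¹ * x), leftTranslate_mem g f⟩
  map_add' _ _ := rfl
  map_smul' _ _ := rfl

theorem leftTranslate_apply (g : G) (f : IndFun ε lam) (x : G) :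
    leftTranslate g f x = f (g⁻¹ * x) := rfl

theorem inner_leftTranslate (g : G) (f f' : IndFun ε lam) :
    inner ℂ (leftTranslate g f) (leftTranslate g f') = inner ℂ f f' := by
  rw [IndFun.inner_eq, IndFun.inner_eq]
  have key : ∀ x : X, IndFun.pairing (leftTranslate g f) (leftTranslate g f') x =
      IndFun.pairing f f' (g⁻¹ • x) := by
    intro x
    induction x using QuotientGroup.induction_on with
    | H x =>
      rw [IndFun.pairing_mk]
      exact (IndFun.pairing_mk f f' (g⁻¹ * x)).symm
  simp_rw [key]
  have h := (measurePreserving_smul g⁻¹).map_eq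
  conv_rhs => rw [← h]
  exact (integral_map (measurable_smul_X _).aemeasurable
    (IndFun.measurable_pairing f f').aestronglyMeasurable).symm

/-- Left translation preserves the Hermitian form. -/
def leftTranslateIsometry (g : G) : IndFun ε lam →ₗᵢ[ℂ] IndFun ε lam :=
  (leftTranslate g).isometryOfInner (inner_leftTranslate g)

/-- The left regular action `τ_{ε,λ}` of `G` on `Ind_H^G(ε ⊗ e^λ)`: `(τ(g) f)(x) = f(g⁻¹ x)`. -/
def leftRegular (ε : ZMod 2) (lam : ImaginaryAxis) : Representation ℂ G (Ind ε lam) where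
  toFun g := (SeparationQuotient.liftCLM
    ((SeparationQuotient.mkCLM ℂ (IndFun ε lam)).comp
      (leftTranslateIsometry g).toContinuousLinearMap)
    (fun _ _ h => (h.map (leftTranslateIsometry g).continuous).map
      SeparationQuotient.continuous_mk |>.eq)).toLinearMap
  map_one' := by
    ext v
    obtain ⟨f, rfl⟩ := SeparationQuotient.surjective_mk v
    refine congrArg SeparationQuotient.mk (IndFun.ext' fun x => ?_)
    exact congrArg f (by simp)
  map_mul' g g' := by
    ext v
    obtain ⟨f, rfl⟩ := SeparationQuotient.surjective_mk v
    refine congrArg SeparationQuotient.mk (IndFun.ext' fun x => ?_)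
    exact congrArg f (by simp [mul_assoc])

theorem leftRegular_mk (g : G) (f : IndFun ε lam) :
    leftRegular ε lam g (SeparationQuotient.mk f) = SeparationQuotient.mk (leftTranslate g f) := rfl

/-- Smooth functions on `G`: smooth in the Iwasawa coordinates `(θ, y, t) ↦ k_θ n̄_y diag(e^t, e^{-t})`,
which form a surjective local diffeomorphism `ℝ³ → G`. -/
def IsSmooth (f : G → ℂ) : Prop :=
  ContDiff ℝ ∞ fun p : ℝ × ℝ × ℝ => f (rot p.1 * nbar p.2.1 * expDiag p.2.2)

/-- Membership in `C_c^∞-Ind_H^G(ε ⊗ e^λ)`: `f` is smooth and its support is contained in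
`{g | g H ∈ C}` for some compact subset `C` of `G / H`. -/
def IsSmoothCompact (f : IndFun ε lam) : Prop :=
  IsSmooth f ∧ ∃ C : Set X, IsCompact C ∧ ∀ g : G, f g ≠ 0 → (g : X) ∈ C

end leftRegular

/-! ### The convolution kernel -/

/-- The constant `Γ((2 - w)/4) / (√π 2^{w/4} Γ(w/4))`, to be used with `w = λ - ν`. -/
def normConst (w : ℂ) : ℂ :=
  1 / ((Real.sqrt Real.pi : ℂ) * (2 : ℂ) ^ (w / 4)) *
    (Complex.Gamma ((2 - w) / 4) / Complex.Gamma (w / 4))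

/-- `a` is the value at `z` (where `Re z ≥ 0`) of the normalized kernel distribution
`Γ((2 - z)/4) / (√π 2^{z/4} Γ(z/4)) |x|^{z/2 - 1}` on the test function `φ`. For `Re w > 0` the
function `|x|^{w/2 - 1}` is locally integrable and the pairing is the integral. On the line
`Re z = 0`, where `|x|^{z/2 - 1}` is not locally integrable, the distribution is the analytic
continuation in the exponent, that is, the limit from the half-plane `Re w > 0`. -/
def HasKernelIntegral (z : ℂ) (φ : ℝ → ℂ) (a : ℂ) : Prop :=
  Tendsto (fun w : ℂ => normConst w * ∫ x : ℝ, ((|x| : ℝ) : ℂ) ^ (w / 2 - 1) * φ x)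
    (𝓝[{w : ℂ | 0 < w.re}] z) (𝓝 a)

/-- `ψ` is the convolution of `φ` with the (even) normalized kernel distribution `u_z`, as
distributions on `ℝ`: `∫ ψ η = ∫ φ (u_z * η)` for all `η ∈ C_c^∞(ℝ)`, where
`(u_z * η)(y) = ⟨u_z, η(· + y)⟩`. -/
def IsKernelConvolution (z : ℂ) (φ ψ : ℝ → ℂ) : Prop :=
  ∀ η : ℝ → ℂ, ContDiff ℝ ∞ η → HasCompactSupport η →
    ∃ κ : ℝ → ℂ, (∀ y, HasKernelIntegral z (fun x => η (x + y)) (κ y)) ∧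
      ∫ y, ψ y * η y = ∫ y, φ y * κ y

/-- `F(g) = c ∫ |x|^{(λ - ν)/2 - 1} f(g n̄_x) dx` for square-integrable `f`: along almost every
coset `g N̄`, the function `F` is the convolution of `f` with the normalized kernel distribution. -/
def IsConvolutionAlongNbar {ε : ZMod 2} {lam nu : ImaginaryAxis} (f : IndFun ε lam)
    (F : IndFun ε nu) : Prop :=
  ∀ᵐ x ∂invMeasure, ∀ g : G, (g : X) = x →
    IsKernelConvolution ((lam : ℂ) - nu) (fun y => f (g * nbar y)) (fun y => F (g * nbar y))

end SL2

end

noncomputable section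

namespace SL2

open scoped FourierTransform SchwartzMap

/-! ### Powers of the absolute value and the Fourier transform -/

/-! The operator acts separately on each coset `g N̄ ≅ ℝ`, where it is convolution with `u_z`, `z =
λ - ν`. The squared norm of `f` is `½ ∫₀^π ∫ |f (k_θ n̄_y)|² dy dθ`, so it is enough that this
convolution be unitary on `L²(ℝ)`. It is, since the Fourier transform of `u_z` is `(√2 π
|ξ|)^(-z/2)`, of modulus one for imaginary `z`; its inverse is convolution with `u_{-z}`, which
gives surjectivity.

The Fourier transform comes from the functional equation of `|x|^(s-1)`
(`integral_abs_cpow_eq_fourier`), obtained by taking Mellin transforms in `t` of the pairing with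
`e^(-π t x²)`. This gives the multiplier formula for `0 < Re w < 2` (`normConst_mul_integral`), and
dominated convergence carries it to the line `Re z = 0`. On `L²(ℝ)` the distributional convolution
is then exactly the unitary operator `kernelOp` (`isKernelConvolution_iff`).

The weight changes from `λ` to `ν` because `H` normalizes `N̄`: with `h = diag(t, t⁻¹)`, `h n̄_y =
n̄_{t⁻² y} h`, so passing from `g` to `g h` dilates the fibre by `c = t⁻²`. The homogeneity of `u_z`
contributes `|c|^(-z/2) = |t|^(λ-ν)`, which turns `|t|^(-λ)` into `|t|^(-ν)`. The sign character is
untouched because `t⁻² > 0`. Left translation commutes with everything done on the right and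
preserves the measure, hence the intertwining property.

What remains is measure theory: the fibrewise `L²` classes must come from one measurable function on
`G` that is equivariant at every point. Its values are recovered as limits of means
(`fiberConv_ae_eq`), and equivariance is built in by working from elements whose second column has
length one (`transform`). The operator itself is handled through the relation
`IsConvolutionAlongNbar`, which is linear, symmetric under `λ ↔ ν`, and single-valued modulo
functions of norm zero. -/

theorem integrableOn_abs_rpow_neg {b : ℝ} (hb : b < 1) :
    IntegrableOn (fun x : ℝ => |x| ^ (-b)) (Set.Icc (-1) 1) := by
  have h1 : IntervalIntegrable (fun x : ℝ => |x| ^ (-b)) volume 0 1 := by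
    refine (intervalIntegral.intervalIntegrable_rpow' (r := -b) (by linarith)).congr ?_
    intro x hx
    rw [Set.uIoc_of_le zero_le_one] at hx
    simp [abs_of_pos hx.1]
  have h2 : IntervalIntegrable (fun x : ℝ => |x| ^ (-b)) volume (-1) 0 := by
    have := (IntervalIntegrable.iff_comp_neg (f := fun x : ℝ => |x| ^ (-b)) (a := 0) (b := 1)).1 h1
    simpa using this.symm
  have h3 := (intervalIntegrable_iff_integrableOn_Icc_of_le (by norm_num)).1 (h2.trans h1)
  exact h3

/-- On `[-1, 1]` the weight is integrable and `f` bounded; outside, the weight is at most one and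
`f` integrable. -/
theorem integrable_abs_rpow_neg_mul {b C : ℝ} (hb0 : 0 ≤ b) (hb : b < 1) {f : ℝ → ℂ}
    (hf : Integrable f) (hC : ∀ x, ‖f x‖ ≤ C) : Integrable fun x : ℝ => |x| ^ (-b) * ‖f x‖ := by
  have hm : AEStronglyMeasurable (fun x : ℝ => |x| ^ (-b)) volume :=
    (by fun_prop : Measurable fun x : ℝ => |x| ^ (-b)).aestronglyMeasurable
  have h1 := (integrable_indicator_iff measurableSet_Icc).2
    ((integrableOn_abs_rpow_neg hb).const_mul C)
  refine (h1.add hf.norm).mono' (hm.mul hf.1.norm) (Eventually.of_forall fun x => ?_)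
  have h0 : 0 ≤ |x| ^ (-b) := Real.rpow_nonneg (abs_nonneg x) _
  have hC0 : 0 ≤ C := (norm_nonneg _).trans (hC 0)
  rw [Real.norm_of_nonneg (mul_nonneg h0 (norm_nonneg _)), Pi.add_apply]
  by_cases hx : x ∈ Set.Icc (-1 : ℝ) 1
  · rw [Set.indicator_of_mem hx]
    nlinarith [mul_le_mul_of_nonneg_left (hC x) h0, norm_nonneg (f x)]
  · rw [Set.indicator_of_notMem hx, zero_add]
    have hx1 : 1 ≤ |x| := by
      by_contra h
      exact hx (abs_le.1 (le_of_lt (not_le.1 h)))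
    have := Real.rpow_le_one_of_one_le_of_nonpos hx1 (neg_nonpos.2 hb0)
    exact mul_le_of_le_one_left (norm_nonneg _) this

/-- The integral of `f` against the Gaussian `e^{-π t x²}`. -/
def gaussianIntegral (f : ℝ → ℂ) (t : ℝ) : ℂ :=
  ∫ x : ℝ, Complex.exp (-(Real.pi * x ^ 2 * t : ℝ)) * f x

/-- By Fubini, since the Mellin transform of `t ↦ e^(-π x² t)` at `a` is `Γ(a) (π x²)^(-a)`. The
bound `Re a < 1/2` is local integrability of `|x|^(-2a)`. -/
theorem mellin_gaussianIntegral {f : ℝ → ℂ} {C : ℝ} (hf : Integrable f) (hC : ∀ x, ‖f x‖ ≤ C)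
    {a : ℂ} (ha0 : 0 < a.re) (ha : a.re < 1 / 2) :
    mellin (gaussianIntegral f) a =
      Complex.Gamma a * (Real.pi : ℂ) ^ (-a) * ∫ x : ℝ, ((|x| : ℝ) : ℂ) ^ (-(2 * a)) * f x := by
  have hne : ∀ᵐ x : ℝ, x ≠ 0 := by simp [ae_iff]
  have hpos : ∀ x : ℝ, x ≠ 0 → 0 < Real.pi * x ^ 2 := fun x hx => by positivity
  let Φ : ℝ → ℝ → ℂ := fun x t =>
    (t : ℂ) ^ (a - 1) * Complex.exp (-(Real.pi * x ^ 2 * t : ℝ)) * f x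
  have inner_eq : ∀ x : ℝ, x ≠ 0 → ∫ t in Set.Ioi (0 : ℝ), Φ x t =
      Complex.Gamma a * (Real.pi : ℂ) ^ (-a) * (((|x| : ℝ) : ℂ) ^ (-(2 * a)) * f x) := by
    intro x hx
    have h1 := Complex.integral_cpow_mul_exp_neg_mul_Ioi ha0 (hpos x hx)
    simp only [Φ]
    rw [integral_mul_const]
    have h2 : ∀ t : ℝ, (t : ℂ) ^ (a - 1) * Complex.exp (-(Real.pi * x ^ 2 * t : ℝ)) =
        (t : ℂ) ^ (a - 1) * Complex.exp (-(((Real.pi * x ^ 2 : ℝ) : ℂ) * t)) := by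
      intro t; push_cast; ring_nf
    simp_rw [h2]
    rw [h1]
    have h3 : (1 / ((Real.pi * x ^ 2 : ℝ) : ℂ)) ^ a =
        (Real.pi : ℂ) ^ (-a) * ((|x| : ℝ) : ℂ) ^ (-(2 * a)) := by
      have : (1 / ((Real.pi * x ^ 2 : ℝ) : ℂ)) = ((Real.pi⁻¹ * (|x|⁻¹ * |x|⁻¹) : ℝ) : ℂ) := by
        rw [← sq_abs x]; push_cast; field_simp
      rw [this]
      rw [Complex.ofReal_mul, Complex.mul_cpow_ofReal_nonneg (by positivity) (by positivity),
        Complex.ofReal_mul, Complex.mul_cpow_ofReal_nonneg (by positivity) (by positivity),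
        Complex.ofReal_inv, Complex.ofReal_inv, Complex.inv_cpow, Complex.inv_cpow,
        ← Complex.cpow_neg, ← Complex.cpow_neg, ← Complex.cpow_add]
      · congr 2; ring
      · exact_mod_cast (abs_pos.2 hx).ne'
      · rw [Complex.arg_ofReal_of_nonneg (abs_nonneg x)]; exact Real.pi_pos.ne
      · rw [Complex.arg_ofReal_of_nonneg Real.pi_pos.le]; exact Real.pi_pos.ne
    rw [h3]; ring
  have hexp : ∀ r : ℝ, ‖Complex.exp (-(r : ℂ))‖ = Real.exp (-r) := fun r => by
    rw [← Complex.ofReal_neg, ← Complex.ofReal_exp, Complex.norm_of_nonneg (Real.exp_pos _).le]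
  have hmeas : AEStronglyMeasurable (Function.uncurry Φ)
      (volume.prod (volume.restrict (Set.Ioi (0 : ℝ)))) := by
    refine AEStronglyMeasurable.mul ?_ hf.1.comp_fst
    exact Measurable.aestronglyMeasurable (by fun_prop)
  have hnorm : ∀ x t : ℝ, 0 < t → ‖Φ x t‖ =
      t ^ (a.re - 1) * Real.exp (-(Real.pi * x ^ 2) * t) * ‖f x‖ := by
    intro x t ht
    simp only [Φ]
    rw [norm_mul, norm_mul, Complex.norm_cpow_eq_rpow_re_of_pos ht, hexp, neg_mul, Complex.sub_re,
      Complex.one_re]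
  have hint : Integrable (Function.uncurry Φ)
      (volume.prod (volume.restrict (Set.Ioi (0 : ℝ)))) := by
    rw [integrable_prod_iff hmeas]
    constructor
    · filter_upwards [hne] with x hx
      simp only [Function.uncurry, Φ]
      refine Integrable.mul_const ?_ _
      have hi : IntegrableOn (fun t : ℝ => t ^ (a.re - 1) * Real.exp (-(Real.pi * x ^ 2) * t))
          (Set.Ioi 0) := by
        have := integrableOn_rpow_mul_exp_neg_mul_rpow (p := 1) (s := a.re - 1)
          (b := Real.pi * x ^ 2) (by linarith) one_pos (hpos x hx)
        simpa using this
      refine Integrable.mono' hi (Measurable.aestronglyMeasurable (by fun_prop)) ?_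
      filter_upwards [ae_restrict_mem measurableSet_Ioi] with t ht
      rw [norm_mul, Complex.norm_cpow_eq_rpow_re_of_pos ht, hexp, neg_mul, Complex.sub_re,
      Complex.one_re]
    · have h1 : Integrable fun x : ℝ => (Real.pi⁻¹ ^ a.re * Real.Gamma a.re) *
          (|x| ^ (-(2 * a.re)) * ‖f x‖) :=
        (integrable_abs_rpow_neg_mul (by linarith) (by linarith) hf hC).const_mul _
      refine h1.congr ?_
      filter_upwards [hne] with x hx
      have : ∫ t in Set.Ioi (0 : ℝ), ‖Function.uncurry Φ (x, t)‖ =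
          ∫ t in Set.Ioi (0 : ℝ), t ^ (a.re - 1) * Real.exp (-(Real.pi * x ^ 2 * t)) * ‖f x‖ := by
        refine setIntegral_congr_fun measurableSet_Ioi fun t ht => ?_
        simp only [Function.uncurry, hnorm x t ht, neg_mul]
      rw [this, integral_mul_const, Real.integral_rpow_mul_exp_neg_mul_Ioi ha0 (hpos x hx)]
      have h3 : (1 / (Real.pi * x ^ 2)) ^ a.re = Real.pi⁻¹ ^ a.re * |x| ^ (-(2 * a.re)) := by
        rw [one_div, mul_inv, Real.mul_rpow (by positivity) (by positivity), ← sq_abs x,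
          Real.inv_rpow (by positivity) (a.re), Real.rpow_neg (abs_nonneg x),
          Real.inv_rpow (by positivity), Real.rpow_mul (abs_nonneg x)]
        norm_num
      rw [h3]; ring
  calc mellin (gaussianIntegral f) a
      = ∫ t in Set.Ioi (0 : ℝ), ∫ x : ℝ, Φ x t := by
        simp only [mellin, gaussianIntegral, Φ, smul_eq_mul]
        refine setIntegral_congr_fun measurableSet_Ioi fun t _ => ?_
        simp only [mul_assoc]
        rw [integral_const_mul]
    _ = ∫ x : ℝ, ∫ t in Set.Ioi (0 : ℝ), Φ x t := (integral_integral_swap hint).symm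
    _ = ∫ x : ℝ, Complex.Gamma a * (Real.pi : ℂ) ^ (-a) *
          (((|x| : ℝ) : ℂ) ^ (-(2 * a)) * f x) :=
        integral_congr_ae (hne.mono inner_eq)
    _ = _ := integral_const_mul _ _

theorem integral_fourier_mul_eq {f g : ℝ → ℂ} (hf : Integrable f) (hg : Integrable g) :
    ∫ x, 𝓕 f x * g x = ∫ x, f x * 𝓕 g x := by
  have := VectorFourier.integral_fourierIntegral_smul_eq_flip (L := innerₗ ℝ) (μ := volume)
    (ν := volume) (e := Real.fourierChar) Real.continuous_fourierChar continuous_inner hf hg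
  rw [flip_innerₗ] at this
  exact this

/-- The Fourier transform of `e^(-π t x²)` is `t^(-1/2) e^(-π ξ²/t)`. Since the Gaussian is even,
`f` may be replaced by `𝓕 (𝓕 f)`, and one transform is moved onto the Gaussian. -/
theorem gaussianIntegral_eq_fourier {f : ℝ → ℂ} (hf : Integrable f) (hf' : Integrable (𝓕 f))
    (hc : Continuous f) {t : ℝ} (ht : 0 < t) :
    gaussianIntegral f t = (t : ℂ) ^ (-(1 / 2) : ℂ) * gaussianIntegral (𝓕 f) t⁻¹ := by
  have ht' : 0 < ((t : ℝ) : ℂ).re := ht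
  have h2 : 𝓕 (fun x : ℝ => Complex.exp (-Real.pi * t * x ^ 2)) = fun ξ : ℝ =>
      (t : ℂ) ^ (-(1 / 2) : ℂ) * Complex.exp (-(Real.pi * ξ ^ 2 * t⁻¹ : ℝ)) := by
    rw [fourier_gaussian_pi ht']
    funext ξ
    rw [Complex.cpow_neg, one_div ((t : ℂ) ^ _)]
    congr 2
    push_cast
    ring
  have hgi : Integrable (fun x : ℝ => Complex.exp (-Real.pi * t * x ^ 2)) := by
    have := integrable_cexp_neg_mul_sq (b := (Real.pi * t : ℝ)) (by
      simpa using mul_pos Real.pi_pos ht)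
    refine this.congr (Eventually.of_forall fun x => ?_)
    simp
  have hfinv : ∀ x, f x = 𝓕 (𝓕 f) (-x) := by
    intro x
    rw [← Real.fourierInv_eq_fourier_neg, hc.fourierInv_fourier_eq hf hf']
  have e1 : gaussianIntegral f t = ∫ x : ℝ, Complex.exp (-Real.pi * t * x ^ 2) * 𝓕 (𝓕 f) x := by
    rw [gaussianIntegral, ← integral_neg_eq_self]
    congr 1
    funext x
    rw [hfinv, neg_neg]
    congr 2
    push_cast
    ring
  rw [e1, ← integral_fourier_mul_eq hgi hf', h2, gaussianIntegral, ← integral_const_mul]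
  simp only [mul_assoc]

/-- The functional equation of the Riesz distributions `|x|^{s - 1}`. -/
theorem integral_abs_cpow_eq_fourier {f : ℝ → ℂ} {C : ℝ} (hf : Integrable f)
    (hC : ∀ x, ‖f x‖ ≤ C) (hc : Continuous f) (hf' : Integrable (𝓕 f)) {s : ℂ} (hs0 : 0 < s.re)
    (hs1 : s.re < 1) :
    Complex.Gamma ((1 - s) / 2) * (Real.pi : ℂ) ^ (-((1 - s) / 2)) *
      ∫ x : ℝ, ((|x| : ℝ) : ℂ) ^ (s - 1) * f x =
    Complex.Gamma (s / 2) * (Real.pi : ℂ) ^ (-(s / 2)) *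
      ∫ x : ℝ, ((|x| : ℝ) : ℂ) ^ (-s) * 𝓕 f x := by
  have hC' : ∀ x, ‖𝓕 f x‖ ≤ ∫ y, ‖f y‖ := fun x =>
    VectorFourier.norm_fourierIntegral_le_integral_norm _ _ _ _ _
  have hr : ((1 - s) / 2).re = (1 - s.re) / 2 := by simp
  have hr' : (s / 2).re = s.re / 2 := by simp
  have h1 := mellin_gaussianIntegral hf hC (a := (1 - s) / 2) (by rw [hr]; linarith)
    (by rw [hr]; linarith)
  have h2 := mellin_gaussianIntegral hf' hC' (a := s / 2) (by rw [hr']; linarith)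
    (by rw [hr']; linarith)
  rw [show -(2 * ((1 - s) / 2)) = s - 1 by ring] at h1
  rw [show -(2 * (s / 2)) = -s by ring] at h2
  rw [← h1, ← h2]
  have h3 : mellin (gaussianIntegral f) ((1 - s) / 2) =
      mellin (fun t : ℝ => (t : ℂ) ^ (-(1 / 2) : ℂ) • gaussianIntegral (𝓕 f) t⁻¹)
        ((1 - s) / 2) := by
    refine setIntegral_congr_fun measurableSet_Ioi fun t ht => ?_
    simp only [gaussianIntegral_eq_fourier hf hf' hc ht, smul_eq_mul]
  -- The factor `t^(-1/2)` shifts the Mellin variable `(1 - s)/2` to `-s/2`, and `t ↦ t⁻¹` reflects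
  -- it to `s/2`.
  rw [h3, mellin_cpow_smul (fun t => gaussianIntegral (𝓕 f) t⁻¹), mellin_comp_inv]
  congr 1
  ring

/-! ### The Fourier transform of the normalized kernel -/

/-- The Fourier transform `(√2 π |ξ|)^{-z/2}` of the normalized kernel distribution `u_z`. -/
def kernelMultiplier (z : ℂ) (ξ : ℝ) : ℂ := ((√2 * Real.pi * |ξ| : ℝ) : ℂ) ^ (-(z / 2))

theorem measurable_kernelMultiplier (z : ℂ) : Measurable (kernelMultiplier z) := by
  unfold kernelMultiplier
  fun_prop

theorem kernelMultiplier_neg_arg (z : ℂ) (ξ : ℝ) :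
    kernelMultiplier z (-ξ) = kernelMultiplier z ξ := by
  simp [kernelMultiplier]

theorem scaled_abs_pos {ξ : ℝ} (hξ : ξ ≠ 0) : 0 < √2 * Real.pi * |ξ| := by positivity

theorem norm_kernelMultiplier (z : ℂ) {ξ : ℝ} (hξ : ξ ≠ 0) :
    ‖kernelMultiplier z ξ‖ = (√2 * Real.pi * |ξ|) ^ (-(z.re / 2)) := by
  rw [kernelMultiplier, Complex.norm_cpow_eq_rpow_re_of_pos (scaled_abs_pos hξ)]
  congr 1
  simp

/-- A bound uniform in the strip, with a locally integrable singularity at `0`: the dominating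
function for the passage to `Re z = 0`. -/
theorem norm_kernelMultiplier_le {z : ℂ} (h0 : 0 ≤ z.re) (h1 : z.re ≤ 1) {ξ : ℝ} (hξ : ξ ≠ 0) :
    ‖kernelMultiplier z ξ‖ ≤ 1 + |ξ| ^ (-(1 / 2) : ℝ) := by
  rw [norm_kernelMultiplier z hξ]
  have hB := scaled_abs_pos hξ
  have hx : 0 < |ξ| := abs_pos.2 hξ
  have hx0 : 0 ≤ |ξ| ^ (-(1 / 2) : ℝ) := Real.rpow_nonneg (abs_nonneg _) _
  rcases le_total 1 (√2 * Real.pi * |ξ|) with h | h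
  · have := Real.rpow_le_one_of_one_le_of_nonpos h (show -(z.re / 2) ≤ 0 by linarith)
    linarith
  · have e1 := Real.rpow_le_rpow_of_exponent_ge hB h (show (-(1 / 2) : ℝ) ≤ -(z.re / 2) by linarith)
    have hle : |ξ| ≤ √2 * Real.pi * |ξ| := by
      have : 1 ≤ √2 * Real.pi := by
        have h2 : 1 ≤ √2 := Real.one_le_sqrt.2 (by norm_num)
        nlinarith [Real.pi_gt_three]
      nlinarith
    have e2 := Real.rpow_le_rpow_of_nonpos hx hle (show (-(1 / 2) : ℝ) ≤ 0 by norm_num)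
    linarith

theorem norm_kernelMultiplier_of_re_eq_zero {z : ℂ} (hz : z.re = 0) {ξ : ℝ} (hξ : ξ ≠ 0) :
    ‖kernelMultiplier z ξ‖ = 1 := by
  rw [norm_kernelMultiplier z hξ, hz]
  simp

/-- The functional equation at `s = w/2`. The normalizing constant cancels both Gamma factors and
leaves `2^(-w/4) π^(-w/2) = (√2 π)^(-w/2)`. -/
theorem normConst_mul_integral {f : ℝ → ℂ} {C : ℝ} (hf : Integrable f)
    (hC : ∀ x, ‖f x‖ ≤ C) (hc : Continuous f) (hf' : Integrable (𝓕 f)) {w : ℂ} (hw0 : 0 < w.re)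
    (hw : w.re < 2) :
    normConst w * ∫ x : ℝ, ((|x| : ℝ) : ℂ) ^ (w / 2 - 1) * f x =
      ∫ ξ : ℝ, kernelMultiplier w ξ * 𝓕 f ξ := by
  have hr : (w / 2).re = w.re / 2 := by simp
  have key := integral_abs_cpow_eq_fourier hf hC hc hf' (s := w / 2) (by rw [hr]; linarith)
    (by rw [hr]; linarith)
  rw [show (1 - w / 2) / 2 = (2 - w) / 4 by ring, show w / 2 / 2 = w / 4 by ring] at key
  have hm : ∀ ξ : ℝ, kernelMultiplier w ξ * 𝓕 f ξ =
      ((2 : ℂ) ^ (-(w / 4)) * (Real.pi : ℂ) ^ (-(w / 2))) *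
        (((|ξ| : ℝ) : ℂ) ^ (-(w / 2)) * 𝓕 f ξ) := by
    intro ξ
    have h2 : ((√2 : ℝ) : ℂ) ^ (-(w / 2)) = (2 : ℂ) ^ (-(w / 4)) := by
      have h0 : ((√2 : ℝ) : ℂ) ≠ 0 := by norm_num
      have hl : Complex.log 2 = ((Real.log 2 : ℝ) : ℂ) := by
        rw [Complex.ofReal_log (by norm_num)]; norm_num
      rw [Complex.cpow_def_of_ne_zero h0, Complex.cpow_def_of_ne_zero two_ne_zero,
        ← Complex.ofReal_log (Real.sqrt_nonneg _), Real.log_sqrt (by norm_num), hl]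
      congr 1
      push_cast
      ring
    rw [kernelMultiplier, Complex.ofReal_mul, Complex.mul_cpow_ofReal_nonneg (by positivity)
      (abs_nonneg _), Complex.ofReal_mul, Complex.mul_cpow_ofReal_nonneg (by positivity)
      (by positivity), h2]
    ring
  simp_rw [hm]
  rw [integral_const_mul]
  set I := ∫ x : ℝ, ((|x| : ℝ) : ℂ) ^ (w / 2 - 1) * f x
  set J := ∫ x : ℝ, ((|x| : ℝ) : ℂ) ^ (-(w / 2)) * 𝓕 f x
  have hG : Complex.Gamma (w / 4) ≠ 0 := Complex.Gamma_ne_zero_of_re_pos (by simpa using hw0)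
  have hpi : (Real.pi : ℂ) ≠ 0 := by exact_mod_cast Real.pi_ne_zero
  have hs : ((Real.sqrt Real.pi : ℝ) : ℂ) = (Real.pi : ℂ) ^ (1 / 2 : ℂ) := by
    rw [Real.sqrt_eq_rpow, Complex.ofReal_cpow Real.pi_pos.le]
    norm_num
  have e1 : (Real.pi : ℂ) ^ (-((2 - w) / 4)) =
      (Real.pi : ℂ) ^ (-(1 / 2) : ℂ) * (Real.pi : ℂ) ^ (w / 4) := by
    rw [← Complex.cpow_add _ _ hpi]; congr 1; ring
  have e2 : (Real.pi : ℂ) ^ (-(w / 2)) =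
      (Real.pi : ℂ) ^ (-(w / 4)) * (Real.pi : ℂ) ^ (-(w / 4)) := by
    rw [← Complex.cpow_add _ _ hpi]; congr 1; ring
  rw [e1, Complex.cpow_neg _ (1 / 2 : ℂ), Complex.cpow_neg _ (w / 4)] at key
  rw [e2, Complex.cpow_neg _ (w / 4), Complex.cpow_neg _ (w / 4), normConst, hs]
  have n1 : (Real.pi : ℂ) ^ (w / 4) ≠ 0 := by simp [Complex.cpow_eq_zero_iff, hpi]
  have n2 : (Real.pi : ℂ) ^ (1 / 2 : ℂ) ≠ 0 := by simp [Complex.cpow_eq_zero_iff, hpi]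
  have n3 : (2 : ℂ) ^ (w / 4) ≠ 0 := by simp [Complex.cpow_eq_zero_iff]
  field_simp at key ⊢
  linear_combination key

theorem tendsto_integral_kernelMultiplier {h : ℝ → ℂ} {C : ℝ} (hh : Integrable h)
    (hC : ∀ x, ‖h x‖ ≤ C) {z : ℂ} (hz : z.re = 0) :
    Tendsto (fun w => ∫ ξ : ℝ, kernelMultiplier w ξ * h ξ) (𝓝[{w : ℂ | 0 < w.re}] z)
      (𝓝 (∫ ξ : ℝ, kernelMultiplier z ξ * h ξ)) := by
  have hne : ∀ᵐ x : ℝ, x ≠ 0 := by simp [ae_iff]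
  refine tendsto_integral_filter_of_dominated_convergence
    (fun ξ => ‖h ξ‖ + |ξ| ^ (-(1 / 2) : ℝ) * ‖h ξ‖) ?_ ?_ ?_ ?_
  · exact Eventually.of_forall fun w =>
      (measurable_kernelMultiplier w).aestronglyMeasurable.mul hh.1
  · have h1 : ∀ᶠ w : ℂ in 𝓝[{w : ℂ | 0 < w.re}] z, w.re < 1 :=
      mem_nhdsWithin_of_mem_nhds
        ((isOpen_lt Complex.continuous_re continuous_const).mem_nhds (by simp [hz]))
    filter_upwards [h1, self_mem_nhdsWithin] with w hw hw0
    filter_upwards [hne] with ξ hξ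
    rw [norm_mul]
    have := mul_le_mul_of_nonneg_right
      (norm_kernelMultiplier_le (le_of_lt hw0) hw.le hξ) (norm_nonneg (h ξ))
    linarith
  · exact hh.norm.add (integrable_abs_rpow_neg_mul (by norm_num) (by norm_num) hh hC)
  · filter_upwards [hne] with ξ hξ
    refine Tendsto.mul_const _ (Tendsto.mono_left ?_ nhdsWithin_le_nhds)
    have : ((√2 * Real.pi * |ξ| : ℝ) : ℂ) ≠ 0 := by exact_mod_cast (scaled_abs_pos hξ).ne'
    unfold kernelMultiplier
    refine Continuous.tendsto (Continuous.const_cpow (by fun_prop) (Or.inl this)) z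

/-- The right side of the multiplier formula still converges on the line `Re z = 0`, so it computes
the limit that defines the kernel integral there. -/
theorem hasKernelIntegral_of_fourier {f : ℝ → ℂ} {C : ℝ} (hf : Integrable f)
    (hC : ∀ x, ‖f x‖ ≤ C) (hc : Continuous f) (hf' : Integrable (𝓕 f)) {z : ℂ} (hz : z.re = 0) :
    HasKernelIntegral z f (∫ ξ : ℝ, kernelMultiplier z ξ * 𝓕 f ξ) := by
  have hC' : ∀ x, ‖𝓕 f x‖ ≤ ∫ y, ‖f y‖ := fun x =>
    VectorFourier.norm_fourierIntegral_le_integral_norm _ _ _ _ _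
  refine (tendsto_integral_kernelMultiplier hf' hC' hz).congr' ?_
  have h1 : ∀ᶠ w : ℂ in 𝓝[{w : ℂ | 0 < w.re}] z, w.re < 1 :=
    mem_nhdsWithin_of_mem_nhds
      ((isOpen_lt Complex.continuous_re continuous_const).mem_nhds (by simp [hz]))
  filter_upwards [h1, self_mem_nhdsWithin] with w hw hw0
  exact (normConst_mul_integral hf hC hc hf' hw0 (by linarith)).symm

/-- The convolution of a test function with the normalized kernel distribution `u_z`. -/
def kernelConv (z : ℂ) (η : ℝ → ℂ) : ℝ → ℂ := 𝓕⁻ fun ξ => kernelMultiplier z ξ * 𝓕 η ξ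

theorem integrable_fourier_of_contDiff {η : ℝ → ℂ} (hη : ContDiff ℝ ∞ η)
    (hs : HasCompactSupport η) : Integrable (𝓕 η) :=
  (𝓕 (hs.toSchwartzMap hη)).integrable

theorem hasKernelIntegral_kernelConv {η : ℝ → ℂ} (hη : ContDiff ℝ ∞ η)
    (hs : HasCompactSupport η) {z : ℂ} (hz : z.re = 0) (y : ℝ) :
    HasKernelIntegral z (fun x => η (x + y)) (kernelConv z η y) := by
  have hη' : ContDiff ℝ ∞ fun x => η (x + y) := hη.comp (by fun_prop)
  have hs' : HasCompactSupport fun x => η (x + y) := hs.comp_homeomorph (Homeomorph.addRight y)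
  obtain ⟨C, hC⟩ := hs'.exists_bound_of_continuous hη'.continuous
  have h := hasKernelIntegral_of_fourier (hη'.continuous.integrable_of_hasCompactSupport hs') hC
    hη'.continuous (integrable_fourier_of_contDiff hη' hs') hz
  have e : kernelConv z η y = ∫ ξ : ℝ, kernelMultiplier z ξ * 𝓕 (fun x => η (x + y)) ξ := by
    rw [kernelConv, Real.fourierInv_eq]
    congr 1
    funext ξ
    have hin : ∀ a b : ℝ, inner ℝ a b = a * b := fun a b => by simp [mul_comm]
    -- Translation becomes the character that turns the pairing into the inverse Fourier integral at
    -- `y`.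
    have h1 : 𝓕 (fun x => η (x + y)) ξ = Real.fourierChar (y * ξ) • 𝓕 η ξ := by
      have := congrFun (VectorFourier.fourierIntegral_comp_add_right Real.fourierChar volume
        (innerₗ ℝ) η y) ξ
      rw [innerₗ_apply_apply, hin] at this
      exact this
    rw [h1, hin, mul_smul_comm, mul_comm ξ y]
  rw [e]
  exact h

/-- The point `z` lies in the closure of the open half-plane, so the limit is along a nontrivial
filter. Identities between kernel integrals are later proved by exhibiting both sides as values of
the same pairing. -/
theorem hasKernelIntegral_unique {z : ℂ} (hz : z.re = 0) {φ : ℝ → ℂ} {a b : ℂ}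
    (ha : HasKernelIntegral z φ a) (hb : HasKernelIntegral z φ b) : a = b := by
  have : (𝓝[{w : ℂ | 0 < w.re}] z).NeBot := by
    rw [← mem_closure_iff_nhdsWithin_neBot, Complex.closure_setOfPred_lt_re]
    exact hz.ge
  exact tendsto_nhds_unique ha hb

/-! ### Fourier multipliers on `L²(ℝ)` -/

/-- The Hilbert space `L²(ℝ)`. -/
abbrev L2 : Type := Lp ℂ 2 (volume : Measure ℝ)

theorem memLp_mul_of_norm_eq_one {m : ℝ → ℂ} (hm : Measurable m) (h1 : ∀ᵐ ξ, ‖m ξ‖ = 1)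
    {f : ℝ → ℂ} (hf : MemLp f 2) : MemLp (fun x => m x * f x) 2 :=
  hf.congr_norm (hm.aestronglyMeasurable.mul hf.1)
    (h1.mono fun x hx => by rw [norm_mul, hx, one_mul])

/-- Multiplication by a unimodular function, as an isometry of `L²(ℝ)`. -/
def mulIsometry (m : ℝ → ℂ) (hm : Measurable m) (h1 : ∀ᵐ ξ, ‖m ξ‖ = 1) : L2 →ₗᵢ[ℂ] L2 where
  toFun f := (memLp_mul_of_norm_eq_one hm h1 (Lp.memLp f)).toLp
  map_add' f g := by
    rw [← MemLp.toLp_add]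
    refine MemLp.toLp_congr _ _ ?_
    filter_upwards [Lp.coeFn_add f g] with x hx
    simp only [hx, Pi.add_apply, mul_add]
  map_smul' c f := by
    rw [RingHom.id_apply, ← MemLp.toLp_const_smul]
    refine MemLp.toLp_congr _ _ ?_
    filter_upwards [Lp.coeFn_smul c f] with x hx
    simp only [hx, Pi.smul_apply, smul_eq_mul, mul_left_comm]
  norm_map' f := by
    change ‖(memLp_mul_of_norm_eq_one hm h1 (Lp.memLp f)).toLp‖ = _
    rw [Lp.norm_toLp, Lp.norm_def]
    congr 1
    exact eLpNorm_congr_norm_ae (h1.mono fun x hx => by rw [norm_mul, hx, one_mul])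

theorem coeFn_mulIsometry (m : ℝ → ℂ) (hm : Measurable m) (h1 : ∀ᵐ ξ, ‖m ξ‖ = 1) (f : L2) :
    mulIsometry m hm h1 f =ᵐ[volume] fun x => m x * f x :=
  MemLp.coeFn_toLp (memLp_mul_of_norm_eq_one hm h1 (Lp.memLp f))

theorem ae_norm_kernelMultiplier {z : ℂ} (hz : z.re = 0) :
    ∀ᵐ ξ : ℝ, ‖kernelMultiplier z ξ‖ = 1 := by
  have hne : ∀ᵐ x : ℝ, x ≠ 0 := by simp [ae_iff]
  exact hne.mono fun ξ hξ => norm_kernelMultiplier_of_re_eq_zero hz hξ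

/-- Multiplication by the Fourier transform of `u_z`. -/
def kernelMulIsometry (z : ℂ) (hz : z.re = 0) : L2 →ₗᵢ[ℂ] L2 :=
  mulIsometry _ (measurable_kernelMultiplier z) (ae_norm_kernelMultiplier hz)

theorem kernelMulIsometry_neg_apply (z : ℂ) (hz : z.re = 0) (hz' : (-z).re = 0) (f : L2) :
    kernelMulIsometry z hz (kernelMulIsometry (-z) hz' f) = f := by
  have hne : ∀ᵐ x : ℝ, x ≠ 0 := by simp [ae_iff]
  refine Lp.ext ?_
  filter_upwards [hne, coeFn_mulIsometry _ (measurable_kernelMultiplier z)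
      (ae_norm_kernelMultiplier hz) (kernelMulIsometry (-z) hz' f),
    coeFn_mulIsometry _ (measurable_kernelMultiplier (-z)) (ae_norm_kernelMultiplier hz') f]
    with x hx h1 h2
  rw [kernelMulIsometry, h1, kernelMulIsometry, h2, ← mul_assoc, kernelMultiplier,
    kernelMultiplier, ← Complex.cpow_add _ _ (by exact_mod_cast (scaled_abs_pos hx).ne')]
  rw [show -(z / 2) + -(-z / 2) = 0 by ring, Complex.cpow_zero, one_mul]

/-- Convolution with the normalized kernel distribution `u_z`, as a unitary operator on `L²(ℝ)`. -/
def kernelOp (z : ℂ) (hz : z.re = 0) : L2 ≃ₗᵢ[ℂ] L2 :=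
  (Lp.fourierTransformₗᵢ ℝ ℂ).trans
    ((LinearIsometryEquiv.ofSurjective (kernelMulIsometry z hz) fun f =>
      ⟨_, kernelMulIsometry_neg_apply z hz (by simp [hz]) f⟩).trans
        (Lp.fourierTransformₗᵢ ℝ ℂ).symm)

theorem kernelOp_apply (z : ℂ) (hz : z.re = 0) (f : L2) :
    kernelOp z hz f = 𝓕⁻ (kernelMulIsometry z hz (𝓕 f)) := rfl

theorem kernelOp_apply_kernelOp_neg (z : ℂ) (hz : z.re = 0) (hz' : (-z).re = 0) (f : L2) :
    kernelOp z hz (kernelOp (-z) hz' f) = f := by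
  rw [kernelOp_apply, kernelOp_apply, FourierTransform.fourier_fourierInv_eq,
    kernelMulIsometry_neg_apply, FourierTransform.fourierInv_fourier_eq]

/-! ### The `L²` Fourier transform against test functions -/

theorem ae_eq_of_integral_mul_eq {f g : ℝ → ℂ} (hf : LocallyIntegrable f) (hg : LocallyIntegrable g)
    (h : ∀ η : ℝ → ℂ, ContDiff ℝ ∞ η → HasCompactSupport η → ∫ x, f x * η x = ∫ x, g x * η x) :
    f =ᵐ[volume] g := by
  refine ae_eq_of_integral_contDiff_smul_eq hf hg fun φ hφ hs => ?_
  have h1 : ContDiff ℝ ∞ fun x => (φ x : ℂ) := Complex.ofRealCLM.contDiff.comp hφ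
  have h2 : HasCompactSupport fun x => (φ x : ℂ) :=
    hs.comp_left (g := fun r : ℝ => (r : ℂ)) Complex.ofReal_zero
  have e : ∀ k : ℝ → ℂ, (fun x => φ x • k x) = fun x => k x * (φ x : ℂ) := fun k => by
    funext x
    rw [Complex.real_smul, mul_comm]
  rw [e, e]
  exact h _ h1 h2

/-- The `L²` Fourier transform agrees with that of tempered distributions, which is defined by
duality. -/
theorem integral_fourier_mul_schwartz (f : L2) (g : 𝓢(ℝ, ℂ)) :
    ∫ x, (𝓕 f : L2) x * g x = ∫ x, f x * 𝓕 g x := by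
  have := congrArg (fun T => T g) (Lp.fourier_toTemperedDistribution_eq f)
  simp only [TemperedDistribution.fourier_apply, Lp.toTemperedDistribution_apply,
    smul_eq_mul] at this
  simp only [mul_comm (g _), mul_comm ((𝓕 g) _)] at this
  exact this.symm

/-- On `L¹ ∩ L²` the abstract transform and the Fourier integral have the same pairings with test
functions. -/
theorem coeFn_fourier_toLp {h : ℝ → ℂ} (h1 : Integrable h) (h2 : MemLp h 2) :
    (𝓕 h2.toLp : L2) =ᵐ[volume] 𝓕 h := by
  have hcont : Continuous (𝓕 h) :=
    VectorFourier.fourierIntegral_continuous Real.continuous_fourierChar continuous_inner h1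
  refine ae_eq_of_integral_mul_eq ((Lp.memLp _).locallyIntegrable one_le_two)
    hcont.locallyIntegrable fun η hη hs => ?_
  have e := integral_fourier_mul_schwartz h2.toLp (hs.toSchwartzMap hη)
  have e2 := integral_fourier_mul_eq h1 (hη.continuous.integrable_of_hasCompactSupport hs)
  rw [e2]
  refine e.trans (integral_congr_ae ?_)
  filter_upwards [h2.coeFn_toLp] with x hx
  rw [hx]
  rfl

theorem integral_fourierInv_mul_eq {f g : ℝ → ℂ} (hf : Integrable f) (hg : Integrable g) :
    ∫ x, 𝓕⁻ f x * g x = ∫ x, f x * 𝓕⁻ g x := by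
  rw [Real.fourierInv_eq_fourier_comp_neg, integral_fourier_mul_eq hf.comp_neg hg,
    ← integral_neg_eq_self]
  simp only [neg_neg, Real.fourierInv_eq_fourier_neg]

theorem integral_fourierInv_mul_schwartz (f : L2) (g : 𝓢(ℝ, ℂ)) :
    ∫ x, (𝓕⁻ f : L2) x * g x = ∫ x, f x * 𝓕⁻ g x := by
  have := congrArg (fun T => T g) (Lp.fourierInv_toTemperedDistribution_eq f)
  simp only [TemperedDistribution.fourierInv_apply, Lp.toTemperedDistribution_apply,
    smul_eq_mul] at this
  simp only [mul_comm (g _), mul_comm ((𝓕⁻ g) _)] at this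
  exact this.symm

theorem coeFn_fourierInv_toLp {h : ℝ → ℂ} (h1 : Integrable h) (h2 : MemLp h 2) :
    (𝓕⁻ h2.toLp : L2) =ᵐ[volume] 𝓕⁻ h := by
  have hcont : Continuous (𝓕⁻ h) := by
    rw [Real.fourierInv_eq_fourier_comp_neg]
    exact VectorFourier.fourierIntegral_continuous Real.continuous_fourierChar continuous_inner
      h1.comp_neg
  refine ae_eq_of_integral_mul_eq ((Lp.memLp _).locallyIntegrable one_le_two)
    hcont.locallyIntegrable fun η hη hs => ?_
  have e := integral_fourierInv_mul_schwartz h2.toLp (hs.toSchwartzMap hη)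
  have e2 := integral_fourierInv_mul_eq h1 (hη.continuous.integrable_of_hasCompactSupport hs)
  rw [e2]
  refine e.trans (integral_congr_ae ?_)
  filter_upwards [h2.coeFn_toLp] with x hx
  rw [hx, SchwartzMap.fourierInv_coe]
  rfl

/-- The bilinear pairing `∫ f g` on `L²(ℝ)`. -/
def bilinPairing : L2 →L[ℂ] L2 →L[ℂ] ℂ := (ContinuousLinearMap.mul ℂ ℂ).lpPairing volume 2 2

theorem bilinPairing_apply (f g : L2) : bilinPairing f g = ∫ x, f x * g x :=
  ContinuousLinearMap.lpPairing_eq_integral _ f g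

/-- Both sides are continuous in `g`, and Schwartz functions are dense. -/
theorem integral_fourier_mul_L2 (f g : L2) :
    ∫ x, (𝓕 f : L2) x * g x = ∫ x, f x * (𝓕 g : L2) x := by
  simp only [← bilinPairing_apply]
  refine DenseRange.induction_on (p := fun g : L2 => bilinPairing (𝓕 f) g = bilinPairing f (𝓕 g))
    (SchwartzMap.denseRange_toLpCLM (p := 2) ENNReal.ofNat_ne_top) g ?_ fun g => ?_
  · exact isClosed_eq (bilinPairing _).continuous
      ((bilinPairing f).continuous.comp (Lp.fourierTransformₗᵢ ℝ ℂ).continuous)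
  · rw [bilinPairing_apply, bilinPairing_apply, SchwartzMap.toLpCLM_apply,
      SchwartzMap.toLp_fourier_eq]
    have e := integral_fourier_mul_schwartz f g
    refine Eq.trans (integral_congr_ae ?_) (e.trans (integral_congr_ae ?_))
    · exact (g.coeFn_toLp 2 volume).mono fun x hx => by simp only [hx]
    · exact ((𝓕 g).coeFn_toLp 2 volume).mono fun x hx => by simp only [hx]

/-! ### Convolution with `u_z` on test functions and on `L²(ℝ)` -/

theorem memLp_of_contDiff {η : ℝ → ℂ} (hη : ContDiff ℝ ∞ η) (hs : HasCompactSupport η) : MemLp η 2 := hη.continuous.memLp_of_hasCompactSupport hs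

theorem memLp_fourier_of_contDiff {η : ℝ → ℂ} (hη : ContDiff ℝ ∞ η) (hs : HasCompactSupport η) : MemLp (𝓕 η) 2 := (𝓕 (hs.toSchwartzMap hη)).memLp 2 volume

theorem integrable_multiplier_fourier {η : ℝ → ℂ} (hη : ContDiff ℝ ∞ η) (hs : HasCompactSupport η)
    {z : ℂ} (hz : z.re = 0) :
    Integrable fun ξ => kernelMultiplier z ξ * 𝓕 η ξ :=
  (integrable_fourier_of_contDiff hη hs).congr'
    ((measurable_kernelMultiplier z).aestronglyMeasurable.mul
      (integrable_fourier_of_contDiff hη hs).1)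
    ((ae_norm_kernelMultiplier hz).mono fun x hx => by rw [norm_mul, hx, one_mul])

theorem memLp_multiplier_fourier {η : ℝ → ℂ} (hη : ContDiff ℝ ∞ η) (hs : HasCompactSupport η)
    {z : ℂ} (hz : z.re = 0) : MemLp (fun ξ => kernelMultiplier z ξ * 𝓕 η ξ) 2 :=
  memLp_mul_of_norm_eq_one (measurable_kernelMultiplier z) (ae_norm_kernelMultiplier hz)
    (memLp_fourier_of_contDiff hη hs)

theorem kernelConv_ae_eq {η : ℝ → ℂ} (hη : ContDiff ℝ ∞ η) (hs : HasCompactSupport η)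
    {z : ℂ} (hz : z.re = 0) :
    kernelConv z η =ᵐ[volume] kernelOp z hz (memLp_of_contDiff hη hs).toLp := by
  have e1 := coeFn_fourierInv_toLp (integrable_multiplier_fourier hη hs hz)
    (memLp_multiplier_fourier hη hs hz)
  have e2 : kernelMulIsometry z hz (𝓕 (memLp_of_contDiff hη hs).toLp) =
      (memLp_multiplier_fourier hη hs hz).toLp := by
    refine Lp.ext ?_
    filter_upwards [coeFn_mulIsometry _ (measurable_kernelMultiplier z)
      (ae_norm_kernelMultiplier hz) (𝓕 (memLp_of_contDiff hη hs).toLp),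
      coeFn_fourier_toLp (hη.continuous.integrable_of_hasCompactSupport hs)
        (memLp_of_contDiff hη hs), (memLp_multiplier_fourier hη hs hz).coeFn_toLp] with x h1 h2 h3
    rw [h3, kernelMulIsometry, h1, h2]
  rw [kernelOp_apply, e2]
  exact e1.symm

/-- The multiplier is even, so `𝓕` and `𝓕⁻` may be exchanged. This is what makes convolution with
`u_z` its own transpose for the bilinear pairing. -/
theorem kernelConv_eq_fourier (z : ℂ) (η : ℝ → ℂ) :
    kernelConv z η = 𝓕 fun ξ => kernelMultiplier z ξ * 𝓕⁻ η ξ := by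
  rw [kernelConv, Real.fourierInv_eq_fourier_comp_neg]
  simp only [kernelMultiplier_neg_arg, Real.fourierInv_eq_fourier_neg]

/-- Each of the three factors `𝓕⁻`, multiplication, `𝓕` of `kernelOp` is moved across the bilinear
pairing in turn. -/
theorem integral_kernelOp_mul {η : ℝ → ℂ} (hη : ContDiff ℝ ∞ η) (hs : HasCompactSupport η)
    {z : ℂ} (hz : z.re = 0) (φ : L2) :
    ∫ y, kernelOp z hz φ y * η y = ∫ y, φ y * kernelConv z η y := by
  let θ : 𝓢(ℝ, ℂ) := 𝓕⁻ (hs.toSchwartzMap hη)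
  have hη2 : MemLp θ 2 := θ.memLp 2 volume
  have hη1 : Integrable θ := θ.integrable
  set γ : ℝ → ℂ := fun ξ => kernelMultiplier z ξ * θ ξ with hγ
  have hγ2 : MemLp γ 2 := memLp_mul_of_norm_eq_one (measurable_kernelMultiplier z)
    (ae_norm_kernelMultiplier hz) hη2
  have hγ1 : Integrable γ := hη1.congr'
    ((measurable_kernelMultiplier z).aestronglyMeasurable.mul hη1.1)
    ((ae_norm_kernelMultiplier hz).mono fun x hx => by rw [norm_mul, hx, one_mul])
  have e1 := integral_fourierInv_mul_schwartz (kernelMulIsometry z hz (𝓕 φ)) (hs.toSchwartzMap hη)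
  have e2 := integral_fourier_mul_L2 φ hγ2.toLp
  calc ∫ y, kernelOp z hz φ y * η y
      = ∫ y, kernelMulIsometry z hz (𝓕 φ) y * θ y := e1
    _ = ∫ y, (𝓕 φ : L2) y * (hγ2.toLp : L2) y := by
        refine integral_congr_ae ?_
        filter_upwards [coeFn_mulIsometry _ (measurable_kernelMultiplier z)
          (ae_norm_kernelMultiplier hz) (𝓕 φ), hγ2.coeFn_toLp] with x h1 h2
        rw [kernelMulIsometry, h1, h2, hγ]
        ring
    _ = ∫ y, φ y * (𝓕 hγ2.toLp : L2) y := e2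
    _ = ∫ y, φ y * kernelConv z η y := by
        refine integral_congr_ae ?_
        filter_upwards [coeFn_fourier_toLp hγ1 hγ2] with x hx
        rw [hx, kernelConv_eq_fourier, hγ]
        simp only [θ, SchwartzMap.fourierInv_coe]
        rfl

/-- On square-integrable functions, convolution with `u_z` is the unitary operator `kernelOp`. -/
theorem isKernelConvolution_iff {z : ℂ} (hz : z.re = 0) {φ ψ : ℝ → ℂ} (hφ : MemLp φ 2)
    (hψ : MemLp ψ 2) : IsKernelConvolution z φ ψ ↔ kernelOp z hz hφ.toLp = hψ.toLp := by
  have key : ∀ η : ℝ → ℂ, ContDiff ℝ ∞ η → HasCompactSupport η →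
      ∫ y, φ y * kernelConv z η y = ∫ y, kernelOp z hz hφ.toLp y * η y := by
    intro η hη hs
    rw [integral_kernelOp_mul hη hs hz]
    exact integral_congr_ae (hφ.coeFn_toLp.mono fun x hx => by simp only [hx])
  constructor
  · intro h
    refine (Lp.ext ((hψ.coeFn_toLp.trans ?_))).symm
    refine ae_eq_of_integral_mul_eq (hψ.locallyIntegrable one_le_two)
      ((Lp.memLp _).locallyIntegrable one_le_two) fun η hη hs => ?_
    obtain ⟨κ, hκ, e⟩ := h η hη hs
    -- The definition only asserts that some `κ` exists; uniqueness of limits identifies it.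
    have : κ = kernelConv z η := funext fun y =>
      hasKernelIntegral_unique hz (hκ y) (hasKernelIntegral_kernelConv hη hs hz y)
    rw [e, this, key η hη hs]
  · intro h η hη hs
    refine ⟨kernelConv z η, hasKernelIntegral_kernelConv hη hs hz, ?_⟩
    rw [key η hη hs, h]
    exact integral_congr_ae (hψ.coeFn_toLp.mono fun x hx => by simp only [hx])

/-! ### Translations and dilations -/

/-- Homogeneity of `|x|^(w/2-1)`: the substitution gives `|c|^(-(w/2-1)) |c|⁻¹ = |c|^(-w/2)` for
every `w`, and this factor is continuous in `w`. -/
theorem HasKernelIntegral.comp_mul {z : ℂ} {φ : ℝ → ℂ} {a : ℂ} (h : HasKernelIntegral z φ a)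
    {c : ℝ} (hc : c ≠ 0) :
    HasKernelIntegral z (fun x => φ (c * x)) (((|c| : ℝ) : ℂ) ^ (-(z / 2)) * a) := by
  have hc' : ((|c| : ℝ) : ℂ) ≠ 0 := by exact_mod_cast (abs_pos.2 hc).ne'
  have hcont : Tendsto (fun w : ℂ => ((|c| : ℝ) : ℂ) ^ (-(w / 2))) (𝓝[{w : ℂ | 0 < w.re}] z)
      (𝓝 (((|c| : ℝ) : ℂ) ^ (-(z / 2)))) :=
    ((Continuous.const_cpow (by fun_prop) (Or.inl hc')).tendsto z).mono_left nhdsWithin_le_nhds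
  refine (hcont.mul h).congr fun w => ?_
  have e : ∀ x : ℝ, ((|x| : ℝ) : ℂ) ^ (w / 2 - 1) * φ (c * x) =
      ((|c| : ℝ) : ℂ) ^ (-(w / 2 - 1)) *
        (((|c * x| : ℝ) : ℂ) ^ (w / 2 - 1) * φ (c * x)) := by
    intro x
    rw [abs_mul, Complex.ofReal_mul, Complex.mul_cpow_ofReal_nonneg (abs_nonneg _) (abs_nonneg _),
      Complex.cpow_neg]
    field_simp [Complex.cpow_ne_zero_iff.2 (Or.inl hc')]
  simp_rw [e]
  rw [integral_const_mul, Measure.integral_comp_mul_left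
    (fun x : ℝ => ((|x| : ℝ) : ℂ) ^ (w / 2 - 1) * φ x) c, Complex.real_smul, abs_inv,
    show -(w / 2) = -(w / 2 - 1) + -1 by ring, Complex.cpow_add _ _ hc', Complex.cpow_neg_one]
  push_cast
  ring

theorem HasKernelIntegral.const_mul {z : ℂ} {φ : ℝ → ℂ} {a : ℂ} (h : HasKernelIntegral z φ a)
    (k : ℂ) : HasKernelIntegral z (fun x => k * φ x) (k * a) := by
  refine (Tendsto.const_mul k h).congr fun w => ?_
  simp_rw [mul_left_comm _ k]
  rw [integral_const_mul, mul_left_comm]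

theorem IsKernelConvolution.comp_add {z : ℂ} {φ ψ : ℝ → ℂ} (h : IsKernelConvolution z φ ψ)
    (c : ℝ) : IsKernelConvolution z (fun y => φ (c + y)) (fun y => ψ (c + y)) := by
  intro η hη hs
  obtain ⟨κ, hκ, e⟩ := h (fun x => η (x + -c)) (hη.comp (by fun_prop))
    (hs.comp_homeomorph (Homeomorph.addRight (-c)))
  refine ⟨fun y => κ (c + y), fun y => ?_, ?_⟩
  · have := hκ (c + y)
    simp only [show ∀ x, x + (c + y) + -c = x + y from fun x => by ring] at this
    exact this
  · rw [integral_add_left_eq_self (fun y => φ y * κ y) c, ← e,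
      ← integral_add_left_eq_self (fun y => ψ y * η (y + -c)) c]
    simp

/-- The dilation is moved onto the test function, where homogeneity of the kernel applies. The
resulting factor is what changes the weight from `λ` to `ν`. -/
theorem IsKernelConvolution.comp_mul {z : ℂ} {φ ψ : ℝ → ℂ} (h : IsKernelConvolution z φ ψ)
    {c : ℝ} (hc : c ≠ 0) :
    IsKernelConvolution z (fun y => φ (c * y))
      (fun y => ((|c| : ℝ) : ℂ) ^ (-(z / 2)) * ψ (c * y)) := by
  intro η hη hs
  obtain ⟨κ, hκ, e⟩ := h (fun x => η (c⁻¹ * x)) (hη.comp (by fun_prop))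
    (hs.comp_homeomorph (Homeomorph.mulLeft₀ c⁻¹ (inv_ne_zero hc)))
  refine ⟨fun y => ((|c| : ℝ) : ℂ) ^ (-(z / 2)) * κ (c * y), fun y => ?_, ?_⟩
  · have := (hκ (c * y)).comp_mul hc
    have e : ∀ x, c⁻¹ * (c * x + c * y) = x + y := fun x => by field_simp
    simpa only [e] using this
  · have e1 : ∀ y, ((|c| : ℝ) : ℂ) ^ (-(z / 2)) * ψ (c * y) * η y =
        ((|c| : ℝ) : ℂ) ^ (-(z / 2)) * (ψ (c * y) * η (c⁻¹ * (c * y))) := fun y => by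
      rw [inv_mul_cancel_left₀ hc]; ring
    simp_rw [e1, mul_left_comm (φ _)]
    rw [integral_const_mul, integral_const_mul,
      Measure.integral_comp_mul_left (fun y => ψ y * η (c⁻¹ * y)), e,
      Measure.integral_comp_mul_left (fun y => φ y * κ y)]

theorem IsKernelConvolution.const_mul {z : ℂ} {φ ψ : ℝ → ℂ} (h : IsKernelConvolution z φ ψ)
    (a : ℂ) : IsKernelConvolution z (fun y => a * φ y) (fun y => a * ψ y) := by
  intro η hη hs
  obtain ⟨κ, hκ, e⟩ := h η hη hs
  refine ⟨κ, hκ, ?_⟩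
  simp_rw [mul_assoc]
  rw [integral_const_mul, integral_const_mul, e]

/-! ### Square integrals along the cosets of `N̄` -/

/-- The square integral of `f` along the coset `g N̄`. -/
def fiberEnergy (f : G → ℂ) (g : G) : ℝ≥0∞ := ∫⁻ y, ‖f (g * nbar y)‖ₑ ^ 2

theorem measurable_fiber {f : G → ℂ} (hf : Measurable f) (g : G) :
    Measurable fun y => f (g * nbar y) :=
  hf.comp (continuous_const.mul continuous_nbar).measurable

theorem continuous_entry (i j : Fin 2) : Continuous fun g : G => g i j := by
  have h : Continuous fun g : G => (g : Matrix (Fin 2) (Fin 2) ℝ) := continuous_subtype_val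
  exact h.matrix_elem i j

theorem measurable_entry (i j : Fin 2) : Measurable fun g : G => g i j :=
  (continuous_entry i j).measurable

/-- A coset `g N̄` is determined by the second column of `g`, so the integrals over cosets already
studied for the invariant measure apply. -/
theorem fiberEnergy_eq_fib (f : G → ℂ) (g : G) :
    fiberEnergy f g = fib (fun x => ‖f x‖ₑ ^ 2) (g 1 1, g 0 1) :=
  (fib_eq (fun x => ‖f x‖ₑ ^ 2) g).symm

theorem measurable_fiberEnergy {f : G → ℂ} (hf : Measurable f) : Measurable (fiberEnergy f) := by
  rw [show fiberEnergy f = _ from funext (fiberEnergy_eq_fib f)]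
  exact (measurable_fib (hf.enorm.pow_const 2)).comp
    ((measurable_entry 1 1).prodMk (measurable_entry 0 1))

theorem fiberEnergy_mul_nbar (f : G → ℂ) (g : G) (c : ℝ) :
    fiberEnergy f (g * nbar c) = fiberEnergy f g := by
  simp only [fiberEnergy, mul_assoc, ← nbar_add]
  exact lintegral_add_left_eq_self (fun y => ‖f (g * nbar y)‖ₑ ^ 2) c

theorem diag_11 {h : G} (hh : h ∈ diagonalSubgroup) : h 1 1 = (h 0 0)⁻¹ := by
  have hd := det_eq h
  rw [hh.1, zero_mul, sub_zero] at hd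
  exact eq_inv_of_mul_eq_one_right hd

theorem diag_mul_nbar {h : G} (hh : h ∈ diagonalSubgroup) (y : ℝ) :
    h * nbar y = nbar ((h 0 0 ^ 2)⁻¹ * y) * h := by
  have h0 := mem_diag_ne hh
  apply G_ext <;> simp [mul_entry, hh.1, hh.2, diag_11 hh]
  field_simp

section equivariant

variable {ε : ZMod 2} {lam : ImaginaryAxis}

theorem IsEquivariant.fiber_mul_diag {f : G → ℂ} (hf : IsEquivariant ε lam f) (g : G) {h : G}
    (hh : h ∈ diagonalSubgroup) (y : ℝ) :
    f (g * h * nbar y) = (signedPow ε lam (h 0 0))⁻¹ * f (g * nbar ((h 0 0 ^ 2)⁻¹ * y)) := by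
  rw [mul_assoc, diag_mul_nbar hh, ← mul_assoc, hf _ h hh]

theorem IsEquivariant.enorm_mul_diag {f : G → ℂ} (hf : IsEquivariant ε lam f) (g : G) {h : G}
    (hh : h ∈ diagonalSubgroup) : ‖f (g * h)‖ₑ = ‖f g‖ₑ := by
  rw [hf g h hh, enorm_mul, ← ofReal_norm (signedPow _ _ _)⁻¹, norm_inv,
    norm_signedPow _ _ (mem_diag_ne hh)]
  simp

theorem IsEquivariant.enorm_out {f : G → ℂ} (hf : IsEquivariant ε lam f) (g : G) :
    ‖f (g : X).out‖ₑ = ‖f g‖ₑ := by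
  obtain ⟨h, hh⟩ := QuotientGroup.mk_out_eq_mul diagonalSubgroup g
  rw [hh, hf.enorm_mul_diag g h.2]

/-- The energy is not a function on `G / H`, but it changes only by a positive finite factor; its
finiteness and its vanishing are therefore well defined on `G / H`. -/
theorem IsEquivariant.fiberEnergy_mul_diag {f : G → ℂ} (hm : Measurable f)
    (hf : IsEquivariant ε lam f) (g : G) {h : G} (hh : h ∈ diagonalSubgroup) :
    fiberEnergy f (g * h) = ENNReal.ofReal (h 0 0 ^ 2) * fiberEnergy f g := by
  have h0 : (h 0 0 ^ 2)⁻¹ ≠ 0 := inv_ne_zero (pow_ne_zero 2 (mem_diag_ne hh))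
  have e : ∀ y, ‖f (g * h * nbar y)‖ₑ ^ 2 = ‖f (g * nbar ((h 0 0 ^ 2)⁻¹ * y))‖ₑ ^ 2 := fun y => by
    rw [mul_assoc, diag_mul_nbar hh, ← mul_assoc, hf.enorm_mul_diag _ hh]
  simp only [fiberEnergy, e]
  rw [lintegral_comp_mul (f := fun y => ‖f (g * nbar y)‖ₑ ^ 2)
    ((measurable_fiber hm g).enorm.pow_const 2) h0, inv_inv, abs_of_nonneg (sq_nonneg _)]

theorem ofReal_sq_ne_zero {h : G} (hh : h ∈ diagonalSubgroup) :
    ENNReal.ofReal (h 0 0 ^ 2) ≠ 0 := by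
  have := mem_diag_ne hh
  simp only [ne_eq, ENNReal.ofReal_eq_zero, not_le]
  positivity

theorem lintegral_enorm_out {f : G → ℂ} (hm : Measurable f) (hf : IsEquivariant ε lam f) :
    ∫⁻ x : X, ‖f x.out‖ₑ ^ 2 ∂invMeasure =
      (1 / 2) * ∫⁻ θ in Set.Ico 0 Real.pi, fiberEnergy f (rot θ) := by
  have hmeas : Measurable fun x : X => ‖f x.out‖ₑ ^ 2 := by
    rw [QuotientGroup.measurable_from_quotient]
    simpa only [Function.comp_def, hf.enorm_out] using hm.enorm.pow_const 2
  rw [lintegral_invMeasure hmeas]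
  simp only [hf.enorm_out, fiberEnergy_eq_fib]
  rfl

end equivariant

theorem fiberEnergy_eq_eLpNorm (f : G → ℂ) (g : G) :
    fiberEnergy f g = eLpNorm (fun y => f (g * nbar y)) 2 volume ^ 2 := by
  have e := eLpNorm_nnreal_pow_eq_lintegral (f := fun y => f (g * nbar y)) (μ := volume)
    (p := 2) two_ne_zero
  simpa [fiberEnergy] using e.symm

theorem memLp_fiber_iff {f : G → ℂ} (hm : Measurable f) (g : G) :
    MemLp (fun y => f (g * nbar y)) 2 ↔ fiberEnergy f g < ⊤ := by
  rw [fiberEnergy_eq_eLpNorm]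
  constructor
  · exact fun h => ENNReal.pow_lt_top h.2
  · exact fun h => ⟨(measurable_fiber hm g).aestronglyMeasurable,
      (ENNReal.pow_lt_top_iff.1 h).resolve_right two_ne_zero⟩

/-- A property of `g ∈ G` invariant under right translation by `H` and by `N̄` holds almost
everywhere on `G / H` if and only if it holds at almost every rotation. -/
theorem ae_invMeasure_iff {p : G → Prop} (hp : MeasurableSet {g | p g})
    (hH : ∀ g, ∀ h ∈ diagonalSubgroup, p (g * h) ↔ p g) (hN : ∀ g c, p (g * nbar c) ↔ p g) :
    (∀ᵐ x ∂invMeasure, ∀ g : G, (g : X) = x → p g) ↔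
      ∀ᵐ θ ∂volume.restrict (Set.Ico 0 Real.pi), p (rot θ) := by
  have hmk : ∀ g : G, (∀ g' : G, (g' : X) = (g : X) → p g') ↔ p g := by
    refine fun g => ⟨fun h => h g rfl, fun h g' e => ?_⟩
    have := hH g _ (QuotientGroup.eq.1 e.symm)
    rw [mul_inv_cancel_left] at this
    exact this.2 h
  have hS : MeasurableSet {x : X | ∀ g : G, (g : X) = x → p g} := by
    change MeasurableSet (QuotientGroup.mk ⁻¹' {x : X | ∀ g : G, (g : X) = x → p g})
    convert hp using 1
    ext g
    exact hmk g
  have hchart : Measurable fun q : ℝ × ℝ => rot q.1 * nbar q.2 :=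
    ((continuous_rot.comp continuous_fst).mul (continuous_nbar.comp continuous_snd)).measurable
  unfold invMeasure
  rw [ae_map_iff measurable_chart.aemeasurable hS, Measure.ae_ennreal_smul_measure_iff (by simp)]
  simp only [hmk]
  rw [Measure.ae_prod_iff_ae_ae (p := fun q : ℝ × ℝ => p (rot q.1 * nbar q.2)) (hchart hp)]
  -- By `N̄`-invariance the condition does not depend on the coordinate `y`.
  simp only [hN, eventually_const]

/-! ### Norm and equality in the induced space, read off the fibres -/

namespace IndFun

variable {ε : ZMod 2} {lam : ImaginaryAxis}

/-- Disintegration of the norm along the cosets of `N̄`: a map preserving the energy of almost every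
fibre is isometric. -/
theorem ofReal_norm_sq (f : IndFun ε lam) :
    ENNReal.ofReal (‖f‖ ^ 2) = (1 / 2) * ∫⁻ θ in Set.Ico 0 Real.pi, fiberEnergy f (rot θ) := by
  rw [← lintegral_enorm_out f.2.1 f.2.2.1]
  have hp : ∀ x, pairing f f x = ((‖f x.out‖ ^ 2 : ℝ) : ℂ) := by
    intro x
    rw [pairing, ← Complex.normSq_eq_conj_mul_self, Complex.normSq_eq_norm_sq]
  have hi : Integrable (fun x : X => ‖f x.out‖ ^ 2) invMeasure := by
    refine (integrable_pairing f f).norm.congr (Eventually.of_forall fun x => ?_)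
    simp only [hp, Complex.norm_real, norm_pow, norm_norm]
  have h1 : ‖f‖ ^ 2 = ∫ x : X, ‖f x.out‖ ^ 2 ∂invMeasure := by
    have := inner_self_eq_norm_sq_to_K (𝕜 := ℂ) f
    rw [inner_eq] at this
    simp_rw [hp] at this
    rw [integral_complex_ofReal] at this
    exact Complex.ofReal_injective (by rw [this]; push_cast; rfl)
  rw [h1, ofReal_integral_eq_lintegral_ofReal hi (Eventually.of_forall fun x => sq_nonneg _)]
  refine lintegral_congr fun x => ?_
  rw [ENNReal.ofReal_pow (norm_nonneg _), ofReal_norm]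

theorem ae_fiberEnergy_lt_top (f : IndFun ε lam) :
    ∀ᵐ θ ∂volume.restrict (Set.Ico 0 Real.pi), fiberEnergy f (rot θ) < ⊤ := by
  refine ae_lt_top ((measurable_fiberEnergy f.2.1).comp continuous_rot.measurable) ?_
  have h := f.2.2.2
  rw [lintegral_enorm_out f.2.1 f.2.2.1] at h
  intro h'
  rw [h'] at h
  simp at h

theorem ae_memLp_fiber (f : IndFun ε lam) :
    ∀ᵐ x ∂invMeasure, ∀ g : G, (g : X) = x → MemLp (fun y => f (g * nbar y)) 2 := by
  simp only [memLp_fiber_iff f.2.1]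
  refine (ae_invMeasure_iff (p := fun g => fiberEnergy f g < ⊤)
    (measurableSet_lt (measurable_fiberEnergy f.2.1) measurable_const) ?_ ?_).2
    f.ae_fiberEnergy_lt_top
  · intro g h hh
    rw [f.2.2.1.fiberEnergy_mul_diag f.2.1 g hh, ENNReal.mul_lt_top_iff]
    simp [ofReal_sq_ne_zero hh]
    intro h0; simp [h0]
  · intro g c
    rw [fiberEnergy_mul_nbar]

/-- The difference has norm zero exactly when almost all its fibre energies vanish. This translates
equality in the quotient into the fibrewise form used by `IsConvolutionAlongNbar`. -/
theorem mk_eq_mk_iff (f f' : IndFun ε lam) :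
    (SeparationQuotient.mk f : Ind ε lam) = SeparationQuotient.mk f' ↔
      ∀ᵐ x ∂invMeasure, ∀ g : G, (g : X) = x →
        (fun y => f (g * nbar y)) =ᵐ[volume] fun y => f' (g * nbar y) := by
  obtain ⟨k, hk⟩ : ∃ k, k = f - f' := ⟨_, rfl⟩
  have e : ∀ g, (fun y => f (g * nbar y)) =ᵐ[volume] (fun y => f' (g * nbar y)) ↔
      fiberEnergy k g = 0 := by
    intro g
    rw [fiberEnergy, lintegral_eq_zero_iff ((measurable_fiber k.2.1 g).enorm.pow_const 2)]
    refine eventually_congr (Eventually.of_forall fun y => ?_)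
    have hk' : k (g * nbar y) = f (g * nbar y) - f' (g * nbar y) := by rw [hk]; rfl
    simp [hk', sub_eq_zero]
  simp only [e]
  rw [ae_invMeasure_iff (p := fun g => fiberEnergy k g = 0)
    (measurable_fiberEnergy k.2.1 (measurableSet_singleton 0))]
  · have h0 := ofReal_norm_sq k
    have h1 := lintegral_eq_zero_iff (μ := volume.restrict (Set.Ico 0 Real.pi))
      ((measurable_fiberEnergy k.2.1).comp continuous_rot.measurable)
    refine Iff.trans ?_ h1
    rw [SeparationQuotient.mk_eq_mk, Metric.inseparable_iff, dist_eq_norm, ← hk]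
    constructor
    · intro h
      rw [h] at h0
      simpa using h0.symm
    · intro h
      simp only [Function.comp_def] at h
      rw [h, mul_zero, ENNReal.ofReal_eq_zero] at h0
      exact pow_eq_zero_iff two_ne_zero |>.1 (le_antisymm h0 (sq_nonneg _))
  · intro g h hh
    rw [k.2.2.1.fiberEnergy_mul_diag k.2.1 g hh]
    simp [ofReal_sq_ne_zero hh]
  · intro g c
    rw [fiberEnergy_mul_nbar]

end IndFun

/-! ### A measurable representative of the fibrewise convolution -/

/-- The limit of a sequence if it exists, and `0` otherwise. -/
def limOrZero (u : ℕ → ℂ) : ℂ :=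
  open Classical in if ∃ c, Tendsto u atTop (𝓝 c) then limUnder atTop u else 0

theorem limOrZero_eq {u : ℕ → ℂ} {c : ℂ} (h : Tendsto u atTop (𝓝 c)) : limOrZero u = c := by
  rw [limOrZero, if_pos ⟨c, h⟩, h.limUnder_eq]

/-- With the default value `0`, scaling is respected even where the limit does not exist; this
yields identities at every point of `G`. -/
theorem limOrZero_const_mul (a : ℂ) (u : ℕ → ℂ) (ha : a ≠ 0) :
    limOrZero (fun n => a * u n) = a * limOrZero u := by
  by_cases h : ∃ c, Tendsto u atTop (𝓝 c)
  · obtain ⟨c, hc⟩ := h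
    rw [limOrZero_eq hc, limOrZero_eq (hc.const_mul a)]
  · have h' : ¬ ∃ c, Tendsto (fun n => a * u n) atTop (𝓝 c) := by
      rintro ⟨c, hc⟩
      refine h ⟨a⁻¹ * c, ?_⟩
      simpa [inv_mul_cancel_left₀ ha] using hc.const_mul a⁻¹
    rw [limOrZero, limOrZero, if_neg h, if_neg h', mul_zero]

theorem measurable_limOrZero {α : Type*} [MeasurableSpace α] {u : ℕ → α → ℂ}
    (hu : ∀ n, Measurable (u n)) : Measurable fun x => limOrZero fun n => u n x := by
  have hs : ∀ n, StronglyMeasurable (u n) := fun n => (hu n).stronglyMeasurable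
  have := @Measurable.ite _ _ _ _ _ _ _ (fun _ => Classical.propDecidable _) (StronglyMeasurable.measurableSet_exists_tendsto (l := atTop) hs)
    (StronglyMeasurable.limUnder (l := atTop) hs).measurable (measurable_const (a := (0 : ℂ)))
  exact this

theorem tendsto_mean_of_hasDerivAt {v : ℝ → ℂ} {y : ℝ}
    (h : ∀ c, HasDerivAt (fun x => ∫ t in c..x, v t) (v y) y) :
    Tendsto (fun n : ℕ => ((n : ℂ) + 1) * ∫ s in (0 : ℝ)..1 / ((n : ℝ) + 1), v (y + s)) atTop
      (𝓝 (v y)) := by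
  -- With base point `c = y` the primitive vanishes at `y`, so the difference quotient is the mean
  -- itself.
  have h1 := (hasDerivAt_iff_tendsto_slope_zero.1 (h y))
  have h2 : Tendsto (fun n : ℕ => 1 / ((n : ℝ) + 1)) atTop (𝓝[≠] 0) :=
    tendsto_nhdsWithin_iff.2 ⟨tendsto_one_div_add_atTop_nhds_zero_nat,
      Eventually.of_forall fun n => by
        have : (0 : ℝ) < 1 / ((n : ℝ) + 1) := by positivity
        exact this.ne'⟩
  refine (h1.comp h2).congr fun n => ?_
  simp only [Function.comp, intervalIntegral.integral_same, sub_zero, Complex.real_smul]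
  rw [intervalIntegral.integral_comp_add_left v y, add_zero]
  push_cast
  rw [one_div, inv_inv]

section mean

variable {z : ℂ} (hz : z.re = 0)

/-- The preimage under `kernelOp` of the indicator function of `(0, 1/(n + 1)]`. -/
def dualIndicator (n : ℕ) : L2 :=
  (kernelOp z hz).symm (indicatorConstLp 2 (measurableSet_Ioc (a := (0 : ℝ)) (b := 1 / ((n : ℝ) + 1)))
    measure_Ioc_lt_top.ne 1)

/-- The mean over `(0, 1/(n + 1)]` of the convolution of `y ↦ f (g n̄_y)` with `u_z`. -/
def fiberMean (f : G → ℂ) (n : ℕ) (g : G) : ℂ :=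
  ((n : ℂ) + 1) * ∫ x, f (g * nbar x) * conj (dualIndicator hz n x)

/-- Because the unitary operator has been moved onto the indicator function, `g` enters only through
`f (g n̄_x)`, which is jointly measurable. Applying `kernelOp` on each fibre would give classes with
no visible measurability in `g`. -/
theorem measurable_fiberMean {f : G → ℂ} (hf : Measurable f) (n : ℕ) :
    Measurable (fiberMean hz f n) := by
  have h2 : Measurable fun q : G × ℝ => f (q.1 * nbar q.2) :=
    hf.comp (continuous_fst.mul (continuous_nbar.comp continuous_snd)).measurable
  have h3 : Measurable fun q : G × ℝ => conj (dualIndicator hz n q.2) :=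
    Complex.continuous_conj.measurable.comp
      ((Lp.stronglyMeasurable (dualIndicator hz n)).measurable.comp measurable_snd)
  have h4 := (h2.mul h3).stronglyMeasurable.integral_prod_right'
    (ν := (volume : Measure ℝ))
  exact h4.measurable.const_mul _

/-- Unitarity: pairing `f` with the preimage of the indicator is pairing the transform of `f` with
the indicator. -/
theorem fiberMean_eq {f : G → ℂ} {g : G} (hf : MemLp (fun y => f (g * nbar y)) 2) (n : ℕ) :
    fiberMean hz f n g =
      ((n : ℂ) + 1) * ∫ s in (0 : ℝ)..1 / ((n : ℝ) + 1), kernelOp z hz hf.toLp s := by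
  have e1 : ∫ x, f (g * nbar x) * conj (dualIndicator hz n x) =
      inner ℂ (dualIndicator hz n) (hf.toLp : L2) := by
    rw [L2.inner_def]
    refine integral_congr_ae ?_
    filter_upwards [hf.coeFn_toLp] with x hx
    rw [hx]
    rfl
  rw [fiberMean, e1, dualIndicator, LinearIsometryEquiv.inner_map_eq_flip,
    LinearIsometryEquiv.symm_symm, L2.inner_indicatorConstLp_one,
    intervalIntegral.integral_of_le (by positivity)]

theorem kernelOp_fiber_mul_nbar {f : G → ℂ} {g : G} (hf : MemLp (fun y => f (g * nbar y)) 2)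
    (c : ℝ) (hf' : MemLp (fun y => f (g * nbar c * nbar y)) 2) :
    kernelOp z hz hf'.toLp =ᵐ[volume] fun y => kernelOp z hz hf.toLp (c + y) := by
  set v : L2 := kernelOp z hz hf.toLp with hv
  have h1 : IsKernelConvolution z (fun y => f (g * nbar y)) v :=
    (isKernelConvolution_iff hz hf (Lp.memLp v)).2 (by rw [Lp.toLp_coeFn])
  have h2 := h1.comp_add c
  simp only [nbar_add, ← mul_assoc] at h2
  have h3 : MemLp (fun y => v (c + y)) 2 :=
    (Lp.memLp v).comp_measurePreserving (measurePreserving_add_left volume c)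
  rw [(isKernelConvolution_iff hz hf' h3).1 h2]
  exact h3.coeFn_toLp

/-- The value at `g` of the convolution of `f` with `u_z` along `g N̄`. -/
def fiberConv (f : G → ℂ) (g : G) : ℂ := limOrZero fun n => fiberMean hz f n g

theorem measurable_fiberConv {f : G → ℂ} (hf : Measurable f) : Measurable (fiberConv hz f) :=
  measurable_limOrZero (measurable_fiberMean hz hf)

/-- Convolution commutes with translation, so the means at `g n̄_y` are means of the transform along
`g N̄` over `(y, y + 1/(n+1)]`; Lebesgue differentiation gives their limit for almost every `y`. -/
theorem fiberConv_ae_eq {f : G → ℂ} (hm : Measurable f) {g : G}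
    (hf : MemLp (fun y => f (g * nbar y)) 2) :
    (fun y => fiberConv hz f (g * nbar y)) =ᵐ[volume] kernelOp z hz hf.toLp := by
  have hloc : LocallyIntegrable (kernelOp z hz hf.toLp) :=
    (Lp.memLp _).locallyIntegrable one_le_two
  filter_upwards [LocallyIntegrable.ae_hasDerivAt_integral hloc] with y hy
  refine limOrZero_eq ((tendsto_mean_of_hasDerivAt hy).congr fun n => ?_)
  have hf' : MemLp (fun x => f (g * nbar y * nbar x)) 2 := by
    rw [memLp_fiber_iff hm] at hf ⊢
    rwa [fiberEnergy_mul_nbar]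
  rw [fiberMean_eq hz hf']
  congr 1
  exact intervalIntegral.integral_congr_ae
    ((kernelOp_fiber_mul_nbar hz hf y hf').mono fun x hx _ => hx.symm)

theorem isKernelConvolution_fiberConv {f : G → ℂ} (hm : Measurable f) {g : G}
    (hf : MemLp (fun y => f (g * nbar y)) 2) :
    IsKernelConvolution z (fun y => f (g * nbar y)) (fun y => fiberConv hz f (g * nbar y)) := by
  have h := fiberConv_ae_eq hz hm hf
  have h2 : MemLp (fun y => fiberConv hz f (g * nbar y)) 2 := (Lp.memLp _).ae_eq h.symm
  rw [isKernelConvolution_iff hz hf h2]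
  exact Lp.ext (h.symm.trans h2.coeFn_toLp.symm)

theorem fiberConv_congr {f : G → ℂ} {g g' : G} {a : ℂ} (ha : a ≠ 0)
    (h : ∀ x, f (g' * nbar x) = a * f (g * nbar x)) : fiberConv hz f g' = a * fiberConv hz f g := by
  rw [fiberConv, fiberConv, ← limOrZero_const_mul _ _ ha]
  congr 1
  funext n
  simp only [fiberMean, h, mul_assoc]
  rw [integral_const_mul, mul_left_comm]

end mean

theorem IsKernelConvolution.fiberEnergy_eq {z : ℂ} (hz : z.re = 0) {f F : G → ℂ} {g : G}
    (hf : MemLp (fun y => f (g * nbar y)) 2) (hF : MemLp (fun y => F (g * nbar y)) 2)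
    (h : IsKernelConvolution z (fun y => f (g * nbar y)) (fun y => F (g * nbar y))) :
    fiberEnergy F g = fiberEnergy f g := by
  have h1 := (isKernelConvolution_iff hz hf hF).1 h
  have h2 := congrArg (fun u : L2 => ‖u‖ₑ) h1
  simp only [Lp.enorm_toLp] at h2
  have h3 : ‖kernelOp z hz hf.toLp‖ₑ = ‖(hf.toLp : L2)‖ₑ := by
    rw [← ofReal_norm, ← ofReal_norm, LinearIsometryEquiv.norm_map]
  rw [h3, Lp.enorm_toLp] at h2
  rw [fiberEnergy_eq_eLpNorm, fiberEnergy_eq_eLpNorm, h2]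

/-! ### The equivariant extension -/

/-- The length of the second column of `g`. -/
def colNorm (g : G) : ℝ := Real.sqrt (g 0 1 ^ 2 + g 1 1 ^ 2)

theorem colNorm_pos (g : G) : 0 < colNorm g := by
  refine Real.sqrt_pos.2 ?_
  have := det_eq g
  by_contra h
  have h1 : g 0 1 = 0 := by nlinarith [sq_nonneg (g 0 1), sq_nonneg (g 1 1)]
  have h2 : g 1 1 = 0 := by nlinarith [sq_nonneg (g 0 1), sq_nonneg (g 1 1)]
  simp [h1, h2] at this

theorem measurable_colNorm : Measurable colNorm :=
  (((measurable_entry 0 1).pow_const 2).add ((measurable_entry 1 1).pow_const 2)).sqrt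

theorem colNorm_mul_nbar (g : G) (c : ℝ) : colNorm (g * nbar c) = colNorm g := by
  simp [colNorm, mul_entry]

theorem colNorm_mul_diag (g : G) {h : G} (hh : h ∈ diagonalSubgroup) :
    colNorm (g * h) = |h 0 0|⁻¹ * colNorm g := by
  have e : (g * h) 0 1 ^ 2 + (g * h) 1 1 ^ 2 = (|h 0 0|⁻¹) ^ 2 * (g 0 1 ^ 2 + g 1 1 ^ 2) := by
    rw [mul_entry, mul_entry, hh.1, diag_11 hh, ← abs_inv, sq_abs]
    ring
  rw [colNorm, e, Real.sqrt_mul (sq_nonneg _), Real.sqrt_sq (by positivity), colNorm]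

/-- The element of `g H` whose second column is the normalized second column of `g`. -/
def normalize (g : G) : G := g * dilation (colNorm g) (colNorm_pos g).ne'

theorem measurable_normalize : Measurable normalize := by
  refine measurable_mk fun i j => ?_
  have e : ∀ g, normalize g i j = g i 0 * dilation (colNorm g) (colNorm_pos g).ne' 0 j +
      g i 1 * dilation (colNorm g) (colNorm_pos g).ne' 1 j := fun g => mul_entry _ _ _ _
  simp only [e]
  fin_cases j
  · simpa [Pi.mul_def] using (measurable_entry i 0).mul measurable_colNorm
  · simpa [Pi.mul_def] using (measurable_entry i 1).mul measurable_colNorm.inv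

/-- Together with the negative case: each coset of `H` has just two normalized elements, differing
by the central element `-1`. -/
theorem normalize_mul_diag_of_pos (g : G) {h : G} (hh : h ∈ diagonalSubgroup) (h0 : 0 < h 0 0) :
    normalize (g * h) = normalize g := by
  have hc := (colNorm_pos g).ne'
  have e := colNorm_mul_diag g hh
  rw [abs_of_pos h0] at e
  rw [normalize, normalize, mul_assoc]
  congr 1
  apply G_ext <;> simp [mul_entry, hh.1, hh.2, e, diag_11 hh, h0.ne']
  field_simp [h0.ne']

theorem normalize_mul_diag_of_neg (g : G) {h : G} (hh : h ∈ diagonalSubgroup) (h0 : h 0 0 < 0) :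
    normalize (g * h) = normalize g * dilation (-1) (by norm_num) := by
  have hc := (colNorm_pos g).ne'
  have e := colNorm_mul_diag g hh
  rw [abs_of_neg h0] at e
  rw [normalize, normalize, mul_assoc, mul_assoc]
  congr 1
  apply G_ext <;> simp [mul_entry, hh.1, hh.2, e, diag_11 hh, h0.ne]
  all_goals field_simp [h0.ne]

section signedPow

variable (ε : ZMod 2)

theorem signedPow_of_pos (z : ℂ) {t : ℝ} (ht : 0 < t) : signedPow ε z t = (t : ℂ) ^ z := by
  simp [signedPow, ht, abs_of_pos ht]

theorem signedPow_of_neg (z : ℂ) {t : ℝ} (ht : t < 0) :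
    signedPow ε z t = (-1) ^ ε.val * ((|t| : ℝ) : ℂ) ^ z := by
  simp [signedPow, ht]

theorem signedPow_mul_of_pos (z : ℂ) {s t : ℝ} (hs : 0 < s) (ht : 0 < t) :
    signedPow ε z (s * t) = signedPow ε z s * signedPow ε z t := by
  rw [signedPow_of_pos ε z hs, signedPow_of_pos ε z ht, signedPow_of_pos ε z (mul_pos hs ht),
    Complex.ofReal_mul, Complex.mul_cpow_ofReal_nonneg hs.le ht.le]

theorem signedPow_inv_of_pos (z : ℂ) {t : ℝ} (ht : 0 < t) :
    signedPow ε z t⁻¹ = (signedPow ε z t)⁻¹ := by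
  rw [signedPow_of_pos ε z ht, signedPow_of_pos ε z (inv_pos.2 ht), Complex.ofReal_inv,
    Complex.inv_cpow]
  rw [Complex.arg_ofReal_of_nonneg ht.le]
  exact Real.pi_pos.ne

end signedPow

section extension

variable {ε : ZMod 2} {lam nu : ImaginaryAxis} (hz : ((lam : ℂ) - nu).re = 0)

/-- The convolution of `f` with `u_{λ - ν}` along the cosets of `N̄`, extended equivariantly from
the elements with normalized second column. -/
def transform (ε : ZMod 2) (f : G → ℂ) (g : G) : ℂ :=
  signedPow ε nu (colNorm g) * fiberConv hz f (normalize g)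

theorem measurable_transform {f : G → ℂ} (hf : Measurable f) : Measurable (transform hz ε f) := by
  refine Measurable.mul ?_ ((measurable_fiberConv hz hf).comp measurable_normalize)
  simp only [signedPow_of_pos _ _ (colNorm_pos _)]
  exact (Complex.measurable_ofReal.comp measurable_colNorm).pow_const _

/-- Exact at every `g`, as membership in `indSubmodule` requires. The positive part of `H` changes
only `colNorm`, and `-1` multiplies all values of `f` by one sign. Without normalization a dilation
would change the intervals of the means, and existence of the limit at a given point need not be
preserved. -/
theorem isEquivariant_transform {f : G → ℂ} (hf : IsEquivariant ε lam f) :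
    IsEquivariant ε nu (transform hz ε f) := by
  intro g h hh
  have hpos := colNorm_pos g
  simp only [transform, colNorm_mul_diag g hh]
  rcases lt_or_gt_of_ne (mem_diag_ne hh) with h0 | h0
  · have ha : 0 < |h 0 0| := abs_pos.2 h0.ne
    have hs : ((-1 : ℂ) ^ ε.val) ≠ 0 := pow_ne_zero _ (by norm_num)
    have e : fiberConv hz f (normalize (g * h)) =
        ((-1 : ℂ) ^ ε.val)⁻¹ * fiberConv hz f (normalize g) := by
      refine fiberConv_congr hz (inv_ne_zero hs) fun x => ?_
      rw [normalize_mul_diag_of_neg g hh h0, hf.fiber_mul_diag _ (dilation_mem _ _) x]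
      rw [signedPow_of_neg]
      · simp
      · simp
    rw [e, signedPow_mul_of_pos _ _ (inv_pos.2 ha) hpos, signedPow_inv_of_pos _ _ ha,
      signedPow_of_neg ε nu h0, signedPow_of_pos ε nu ha, mul_inv]
    ring
  · rw [abs_of_pos h0, normalize_mul_diag_of_pos g hh h0,
      signedPow_mul_of_pos _ _ (inv_pos.2 h0) hpos, signedPow_inv_of_pos _ _ h0, mul_assoc]

theorem isKernelConvolution_transform {f : G → ℂ} (hm : Measurable f) (hf : IsEquivariant ε lam f)
    {g : G} (hg : fiberEnergy f g < ⊤) :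
    IsKernelConvolution ((lam : ℂ) - nu) (fun y => f (g * nbar y))
      (fun y => transform hz ε f (g * nbar y)) := by
  set r := colNorm g with hr
  have hr0 : 0 < r := colNorm_pos g
  have hrc : ((r : ℝ) : ℂ) ≠ 0 := by exact_mod_cast hr0.ne'
  have hd : dilation r hr0.ne' ∈ diagonalSubgroup := dilation_mem _ _
  have hg' : fiberEnergy f (normalize g) < ⊤ := by
    rw [normalize, hf.fiberEnergy_mul_diag hm g (dilation_mem _ _)]
    exact ENNReal.mul_lt_top ENNReal.ofReal_lt_top hg
  -- Normalizing `g n̄_y` gives `normalize g` times `n̄_{r² y}`. The dilation factor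
  -- `(r²)^(-(λ-ν)/2)` times the character `r^λ` is `r^ν`.
  have key := (isKernelConvolution_fiberConv hz hm ((memLp_fiber_iff hm _).2 hg')).comp_mul
    (c := r ^ 2) (pow_ne_zero 2 hr0.ne')
  have key' := key.const_mul (signedPow ε lam r)
  have e1 : ∀ y, signedPow ε lam r * f (normalize g * nbar (r ^ 2 * y)) = f (g * nbar y) := by
    intro y
    rw [normalize, hf.fiber_mul_diag g hd, dilation_00, inv_mul_cancel_left₀ (pow_ne_zero 2 hr0.ne'),
      mul_inv_cancel_left₀]
    rw [← norm_ne_zero_iff, norm_signedPow _ _ hr0.ne']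
    exact one_ne_zero
  have e2 : ∀ y, normalize (g * nbar y) = normalize g * nbar (r ^ 2 * y) := by
    intro y
    have hc : colNorm (g * nbar y) = r := colNorm_mul_nbar g y
    simp only [normalize, hc, ← hr]
    rw [mul_assoc, mul_assoc, diag_mul_nbar hd, dilation_00,
      inv_mul_cancel_left₀ (pow_ne_zero 2 hr0.ne')]
  have e3 : ∀ y, signedPow ε lam r * (((|r ^ 2| : ℝ) : ℂ) ^ (-(((lam : ℂ) - nu) / 2)) *
      fiberConv hz f (normalize g * nbar (r ^ 2 * y))) = transform hz ε f (g * nbar y) := by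
    intro y
    rw [transform, e2, colNorm_mul_nbar, ← hr, ← mul_assoc, signedPow_of_pos ε _ hr0,
      signedPow_of_pos ε _ hr0, abs_of_pos (by positivity)]
    congr 1
    rw [sq, Complex.ofReal_mul, Complex.mul_cpow_ofReal_nonneg hr0.le hr0.le,
      ← Complex.cpow_add _ _ hrc, ← Complex.cpow_add _ _ hrc]
    congr 1
    ring
  simp only [e1, e3] at key'
  exact key'

theorem colNorm_normalize (g : G) : colNorm (normalize g) = 1 := by
  have h := (colNorm_pos g)
  rw [normalize, colNorm_mul_diag g (dilation_mem _ _), dilation_00, abs_of_pos h,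
    inv_mul_cancel₀ h.ne']

theorem transform_normalize_mul_nbar (ε : ZMod 2) (f : G → ℂ) (g : G) (y : ℝ) :
    transform hz ε f (normalize g * nbar y) = fiberConv hz f (normalize g * nbar y) := by
  have h1 : colNorm (normalize g * nbar y) = 1 := by
    rw [colNorm_mul_nbar, colNorm_normalize]
  have h2 : normalize (normalize g * nbar y) = normalize g * nbar y := by
    conv_lhs => rw [normalize]
    simp only [h1]
    apply G_ext <;> simp [mul_entry]
  rw [transform, h2, h1, signedPow_of_pos _ _ one_pos]
  simp

theorem fiberEnergy_transform {f : G → ℂ} (hm : Measurable f) (hf : IsEquivariant ε lam f)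
    {g : G} (hg : fiberEnergy f g < ⊤) :
    fiberEnergy (transform hz ε f) g = fiberEnergy f g := by
  have hd := dilation_mem (colNorm g) (colNorm_pos g).ne'
  have hg' : fiberEnergy f (normalize g) < ⊤ := by
    rw [normalize, hf.fiberEnergy_mul_diag hm g hd]
    exact ENNReal.mul_lt_top ENNReal.ofReal_lt_top hg
  have hL := (memLp_fiber_iff hm _).2 hg'
  have h1 : fiberEnergy (transform hz ε f) (normalize g) = fiberEnergy f (normalize g) := by
    have e : fiberEnergy (transform hz ε f) (normalize g) =
        fiberEnergy (fiberConv hz f) (normalize g) := by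
      simp only [fiberEnergy, transform_normalize_mul_nbar]
    rw [e]
    exact (isKernelConvolution_fiberConv hz hm hL).fiberEnergy_eq hz hL
      ((Lp.memLp _).ae_eq (fiberConv_ae_eq hz hm hL).symm)
  rw [normalize, hf.fiberEnergy_mul_diag hm g hd,
    (isEquivariant_transform hz hf).fiberEnergy_mul_diag (measurable_transform hz hm) g hd] at h1
  exact (ENNReal.mul_right_inj (ofReal_sq_ne_zero hd) ENNReal.ofReal_ne_top).1 h1

end extension

/-! ### The intertwining operator built from the convolution relation -/

section relation

variable {ε : ZMod 2} {lam nu : ImaginaryAxis}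

theorem re_sub_eq_zero (lam nu : ImaginaryAxis) : ((lam : ℂ) - nu).re = 0 := by
  rw [Complex.sub_re, lam.2, nu.2, sub_zero]

theorem mem_indSubmodule_of_fiberEnergy_eq (f : IndFun ε lam) {F : G → ℂ} (hm : Measurable F)
    (he : IsEquivariant ε nu F) (h : ∀ g, fiberEnergy f g < ⊤ → fiberEnergy F g = fiberEnergy f g) :
    F ∈ indSubmodule ε nu := by
  refine ⟨hm, he, ?_⟩
  have h1 := f.2.2.2
  rw [lintegral_enorm_out f.2.1 f.2.2.1] at h1
  rw [lintegral_enorm_out hm he]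
  rwa [lintegral_congr_ae (f.ae_fiberEnergy_lt_top.mono fun θ hθ => h _ hθ)]

theorem norm_eq_of_fiberEnergy_eq (f : IndFun ε lam) (F : IndFun ε nu)
    (h : ∀ g, fiberEnergy f g < ⊤ → fiberEnergy F g = fiberEnergy f g) : ‖F‖ = ‖f‖ := by
  have h1 := IndFun.ofReal_norm_sq f
  rw [← lintegral_congr_ae (f.ae_fiberEnergy_lt_top.mono fun θ hθ => h _ hθ),
    ← IndFun.ofReal_norm_sq F, ENNReal.ofReal_eq_ofReal_iff (sq_nonneg _) (sq_nonneg _)] at h1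
  exact ((sq_eq_sq₀ (norm_nonneg _) (norm_nonneg _)).1 h1).symm

/-- Convolution with `u_{λ - ν}` on `L²(ℝ)`. -/
abbrev convOp (lam nu : ImaginaryAxis) : L2 ≃ₗᵢ[ℂ] L2 :=
  kernelOp ((lam : ℂ) - nu) (re_sub_eq_zero lam nu)

/-- Almost all fibres are square-integrable, so the relation becomes an operator equation on
`L²(ℝ)`; additivity, uniqueness and symmetry follow from those of `convOp`. -/
theorem isConvolutionAlongNbar_iff (f : IndFun ε lam) (F : IndFun ε nu) :
    IsConvolutionAlongNbar f F ↔ ∀ᵐ x ∂invMeasure, ∀ g : G, (g : X) = x →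
      ∃ (hf : MemLp (fun y => f (g * nbar y)) 2) (hF : MemLp (fun y => F (g * nbar y)) 2),
        convOp lam nu hf.toLp = hF.toLp := by
  unfold IsConvolutionAlongNbar
  refine eventually_congr ?_
  filter_upwards [f.ae_memLp_fiber, F.ae_memLp_fiber] with x h1 h2
  refine forall_congr' fun g => forall_congr' fun hg => ?_
  rw [isKernelConvolution_iff (re_sub_eq_zero lam nu) (h1 g hg) (h2 g hg)]
  exact ⟨fun h => ⟨_, _, h⟩, fun ⟨_, _, h⟩ => h⟩

theorem isConvolutionAlongNbar_of_forall {f : IndFun ε lam} {F : IndFun ε nu}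
    (h : ∀ g, fiberEnergy f g < ⊤ → IsKernelConvolution ((lam : ℂ) - nu)
      (fun y => f (g * nbar y)) (fun y => F (g * nbar y))) : IsConvolutionAlongNbar f F := by
  filter_upwards [f.ae_memLp_fiber] with x hx g hg
  exact h g ((memLp_fiber_iff f.2.1 g).1 (hx g hg))

namespace IsConvolutionAlongNbar

theorem exists_norm_eq (nu : ImaginaryAxis) (f : IndFun ε lam) :
    ∃ F : IndFun ε nu, IsConvolutionAlongNbar f F ∧ ‖F‖ = ‖f‖ := by
  have hz := re_sub_eq_zero lam nu
  have hE : ∀ g, fiberEnergy f g < ⊤ → fiberEnergy (transform hz ε f) g = fiberEnergy f g :=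
    fun g hg => fiberEnergy_transform hz f.2.1 f.2.2.1 hg
  refine ⟨⟨transform hz ε f, mem_indSubmodule_of_fiberEnergy_eq f (measurable_transform hz f.2.1)
    (isEquivariant_transform hz f.2.2.1) hE⟩, ?_, norm_eq_of_fiberEnergy_eq _ _ hE⟩
  exact isConvolutionAlongNbar_of_forall fun g hg =>
    isKernelConvolution_transform hz f.2.1 f.2.2.1 hg

theorem add {f f' : IndFun ε lam} {F F' : IndFun ε nu} (h : IsConvolutionAlongNbar f F)
    (h' : IsConvolutionAlongNbar f' F') : IsConvolutionAlongNbar (f + f') (F + F') := by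
  rw [isConvolutionAlongNbar_iff] at h h' ⊢
  filter_upwards [h, h'] with x hx hx' g hg
  obtain ⟨h1, h2, h3⟩ := hx g hg
  obtain ⟨h1', h2', h3'⟩ := hx' g hg
  refine ⟨h1.add h1', h2.add h2', ?_⟩
  have e := congrArg₂ (· + ·) h3 h3'
  simp only [← map_add, ← MemLp.toLp_add] at e
  exact e

theorem smul {f : IndFun ε lam} {F : IndFun ε nu} (h : IsConvolutionAlongNbar f F) (c : ℂ) :
    IsConvolutionAlongNbar (c • f) (c • F) := by
  rw [isConvolutionAlongNbar_iff] at h ⊢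
  filter_upwards [h] with x hx g hg
  obtain ⟨h1, h2, h3⟩ := hx g hg
  refine ⟨h1.const_smul c, h2.const_smul c, ?_⟩
  have e := congrArg (fun u => c • u) h3
  simp only [← map_smul, ← MemLp.toLp_const_smul] at e
  exact e

/-- Convolution with `u_{ν - λ}` undoes convolution with `u_{λ - ν}`. This is the source of
surjectivity. -/
theorem symm {f : IndFun ε lam} {F : IndFun ε nu} (h : IsConvolutionAlongNbar f F) :
    IsConvolutionAlongNbar F f := by
  rw [isConvolutionAlongNbar_iff] at h ⊢
  filter_upwards [h] with x hx g hg
  obtain ⟨h1, h2, h3⟩ := hx g hg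
  refine ⟨h2, h1, ?_⟩
  have hz := re_sub_eq_zero nu lam
  have e := kernelOp_apply_kernelOp_neg ((nu : ℂ) - lam) hz
    (by rw [neg_sub]; exact re_sub_eq_zero lam nu) h1.toLp
  simp only [neg_sub] at e
  rw [← h3]
  exact e

theorem unique {f : IndFun ε lam} {F F' : IndFun ε nu} (h : IsConvolutionAlongNbar f F)
    (h' : IsConvolutionAlongNbar f F') :
    (SeparationQuotient.mk F : Ind ε nu) = SeparationQuotient.mk F' := by
  rw [isConvolutionAlongNbar_iff] at h h'
  rw [IndFun.mk_eq_mk_iff]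
  filter_upwards [h, h'] with x hx hx' g hg
  obtain ⟨h1, h2, h3⟩ := hx g hg
  obtain ⟨h1', h2', h3'⟩ := hx' g hg
  exact (MemLp.toLp_eq_toLp_iff h2 h2').1 (h3.symm.trans h3')

theorem congr_right {f : IndFun ε lam} {F F' : IndFun ε nu} (h : IsConvolutionAlongNbar f F)
    (hF : (SeparationQuotient.mk F : Ind ε nu) = SeparationQuotient.mk F') :
    IsConvolutionAlongNbar f F' := by
  rw [IndFun.mk_eq_mk_iff] at hF
  filter_upwards [h, hF] with x hx hx' g hg η hη hs
  obtain ⟨κ, hκ, e⟩ := hx g hg η hη hs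
  refine ⟨κ, hκ, ?_⟩
  rw [← e]
  exact integral_congr_ae ((hx' g hg).mono fun y hy => by simp only [hy])

/-- Left translation carries the coset `g' N̄` to `g⁻¹ g' N̄` with the same parameter `y`, and by
invariance of the measure it preserves null sets of `G / H`. -/
theorem leftTranslate {f : IndFun ε lam} {F : IndFun ε nu} (h : IsConvolutionAlongNbar f F)
    (g : G) : IsConvolutionAlongNbar (leftTranslate g f) (leftTranslate g F) := by
  have h1 := (measurePreserving_smul g⁻¹).quasiMeasurePreserving.ae h
  filter_upwards [h1] with x hx g' hg'
  have := hx (g⁻¹ * g') (by rw [← hg']; rfl)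
  simpa only [leftTranslate_apply, mul_assoc] using this

end IsConvolutionAlongNbar

/-- A convolution of `f` with `u_{λ - ν}` along the cosets of `N̄`. -/
def chooseConv (nu : ImaginaryAxis) (f : IndFun ε lam) : IndFun ε nu :=
  (IsConvolutionAlongNbar.exists_norm_eq nu f).choose

theorem chooseConv_spec (nu : ImaginaryAxis) (f : IndFun ε lam) :
    IsConvolutionAlongNbar f (chooseConv nu f) :=
  (IsConvolutionAlongNbar.exists_norm_eq nu f).choose_spec.1

theorem norm_chooseConv (nu : ImaginaryAxis) (f : IndFun ε lam) : ‖chooseConv nu f‖ = ‖f‖ :=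
  (IsConvolutionAlongNbar.exists_norm_eq nu f).choose_spec.2

/-- Convolution with `u_{λ - ν}` along the cosets of `N̄`, on functions. -/
def intertwinerFun (nu : ImaginaryAxis) : IndFun ε lam →ₗᵢ[ℂ] Ind ε nu where
  toFun f := SeparationQuotient.mk (chooseConv nu f)
  -- The chosen representatives need not depend linearly on `f`; their classes do, by uniqueness.
  map_add' f f' := (chooseConv_spec nu (f + f')).unique
    ((chooseConv_spec nu f).add (chooseConv_spec nu f'))
  map_smul' c f := (chooseConv_spec nu (c • f)).unique ((chooseConv_spec nu f).smul c)
  norm_map' f := norm_chooseConv nu f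

/-- The intertwining operator `T_λ^ν` as an isometry. -/
def intertwinerIsometry (ε : ZMod 2) (lam nu : ImaginaryAxis) : Ind ε lam →ₗᵢ[ℂ] Ind ε nu where
  toLinearMap := (SeparationQuotient.liftCLM (intertwinerFun nu).toContinuousLinearMap
    fun _ _ h => (h.map (intertwinerFun nu).continuous).eq).toLinearMap
  norm_map' v := by
    obtain ⟨f, rfl⟩ := SeparationQuotient.surjective_mk v
    exact (intertwinerFun nu).norm_map f

theorem intertwinerIsometry_mk (f : IndFun ε lam) :
    intertwinerIsometry ε lam nu (SeparationQuotient.mk f) =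
      SeparationQuotient.mk (chooseConv nu f) := rfl

theorem intertwinerIsometry_mk_eq_iff (f : IndFun ε lam) (F : IndFun ε nu) :
    intertwinerIsometry ε lam nu (SeparationQuotient.mk f) = SeparationQuotient.mk F ↔
      IsConvolutionAlongNbar f F := by
  rw [intertwinerIsometry_mk]
  exact ⟨fun h => (chooseConv_spec nu f).congr_right h, fun h => (chooseConv_spec nu f).unique h⟩

theorem intertwinerIsometry_surjective :
    Function.Surjective (intertwinerIsometry ε lam nu) := by
  intro v
  obtain ⟨F, rfl⟩ := SeparationQuotient.surjective_mk v
  exact ⟨SeparationQuotient.mk (chooseConv lam F),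
    (intertwinerIsometry_mk_eq_iff _ _).2 (chooseConv_spec lam F).symm⟩

end relation

/-! ### Smooth functions with compact support modulo `H` -/

theorem expDiag_mem (t : ℝ) : expDiag t ∈ diagonalSubgroup := ⟨rfl, rfl⟩

/-- Smoothness is defined in Iwasawa coordinates; in these, `g N̄` is an affine line in the `y`
direction with `θ` and `t` fixed. -/
theorem exists_iwasawa (g : G) :
    ∃ θ t c : ℝ, ∀ x, g * nbar x = rot θ * nbar ((expDiag t 0 0 ^ 2)⁻¹ * (c + x)) * expDiag t := by
  have hr := colNorm_pos g
  have hsq : colNorm g ^ 2 = g 0 1 ^ 2 + g 1 1 ^ 2 := Real.sq_sqrt (by positivity)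
  -- The second column of `k_θ diag(e^t, e^{-t})` is `e^{-t} (sin θ, cos θ)`, so `θ` is the argument
  -- of `w` and `e^{-t}` its modulus.
  let w : ℂ := ⟨g 1 1, g 0 1⟩
  have hw : ‖w‖ = colNorm g := by
    rw [Complex.norm_def, Complex.normSq_apply, colNorm]
    congr 1
    simp only [w]
    ring
  have hw0 : w ≠ 0 := norm_ne_zero_iff.1 (by rw [hw]; exact hr.ne')
  have h01 : g 0 1 = (rot (Complex.arg w) * expDiag (-Real.log (colNorm g))) 0 1 := by
    rw [mul_entry]
    simp only [rot, expDiag, Matrix.of_apply, Matrix.cons_val', Matrix.cons_val_zero,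
      Matrix.cons_val_one, Matrix.cons_val_fin_one, mul_zero, zero_add, neg_neg,
      Real.exp_log hr, Complex.sin_arg, hw]
    field_simp
    rfl
  have h11 : g 1 1 = (rot (Complex.arg w) * expDiag (-Real.log (colNorm g))) 1 1 := by
    rw [mul_entry]
    simp only [rot, expDiag, Matrix.of_apply, Matrix.cons_val', Matrix.cons_val_zero,
      Matrix.cons_val_one, Matrix.cons_val_fin_one, mul_zero, zero_add, neg_neg,
      Real.exp_log hr, Complex.cos_arg hw0, hw]
    field_simp
    rfl
  obtain ⟨c, hc⟩ := exists_nbar h01 h11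
  refine ⟨Complex.arg w, -Real.log (colNorm g), c, fun x => ?_⟩
  conv_lhs => rw [hc]
  rw [mul_assoc, ← nbar_add, mul_assoc, diag_mul_nbar (expDiag_mem _), ← mul_assoc]

theorem IsSmooth.contDiff_fiber {f : G → ℂ} (hf : IsSmooth f) (g : G) :
    ContDiff ℝ ∞ fun x => f (g * nbar x) := by
  obtain ⟨θ, t, c, h⟩ := exists_iwasawa g
  have h1 : ContDiff ℝ ∞ fun x : ℝ => ((θ, (expDiag t 0 0 ^ 2)⁻¹ * (c + x), t) : ℝ × ℝ × ℝ) := by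
    fun_prop
  have h2 : ContDiff ℝ ∞ fun p : ℝ × ℝ × ℝ => f (rot p.1 * nbar p.2.1 * expDiag p.2.2) := hf
  have h3 := h2.comp h1
  simp only [Function.comp_def] at h3
  simpa only [h] using h3

/-- The inner product `ab + cd` of the columns of `g = (a, b; c, d)`. -/
def colInner (g : G) : ℝ := g 0 0 * g 0 1 + g 1 0 * g 1 1

theorem colInner_mul_nbar (g : G) (x : ℝ) :
    colInner (g * nbar x) = colInner g + x * (g 0 1 ^ 2 + g 1 1 ^ 2) := by
  simp [colInner, mul_entry]
  ring

theorem colInner_mul_diag (g : G) {h : G} (hh : h ∈ diagonalSubgroup) :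
    colInner (g * h) = colInner g := by
  have := mem_diag_ne hh
  simp [colInner, mul_entry, hh.1, hh.2, diag_11 hh]
  field_simp

theorem continuous_colInner : Continuous colInner :=
  ((continuous_entry 0 0).mul (continuous_entry 0 1)).add
    ((continuous_entry 1 0).mul (continuous_entry 1 1))

/-- `colInner` descends to a continuous function on `G / H`. Along `g N̄` it is affine in `x` with
positive slope, so a bound on it confines `x` to a bounded interval. -/
theorem exists_bound_colInner {C : Set X} (hC : IsCompact C) :
    ∃ B, ∀ g : G, (g : X) ∈ C → |colInner g| ≤ B := by
  have e : ∀ g : G, colInner (g : X).out = colInner g := fun g => by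
    obtain ⟨h, hh⟩ := QuotientGroup.mk_out_eq_mul diagonalSubgroup g
    rw [hh, colInner_mul_diag g h.2]
  have hc : Continuous fun x : X => colInner x.out := by
    refine isQuotientMap_quotient_mk'.continuous_iff.2 ?_
    exact continuous_colInner.congr fun g => (e g).symm
  obtain ⟨B, hB⟩ := hC.exists_bound_of_continuousOn hc.continuousOn
  exact ⟨B, fun g hg => by simpa [e] using hB _ hg⟩

section smooth

variable {ε : ZMod 2} {lam nu : ImaginaryAxis}

theorem IsSmoothCompact.hasCompactSupport_fiber {f : IndFun ε lam} (hf : IsSmoothCompact f)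
    (g : G) : HasCompactSupport fun x => f (g * nbar x) := by
  obtain ⟨_, C, hC, hfC⟩ := hf
  obtain ⟨B, hB⟩ := exists_bound_colInner hC
  have hs : 0 < g 0 1 ^ 2 + g 1 1 ^ 2 := Real.sqrt_pos.1 (colNorm_pos g)
  refine HasCompactSupport.of_support_subset_isCompact
    (isCompact_closedBall (0 : ℝ) ((B + |colInner g|) / (g 0 1 ^ 2 + g 1 1 ^ 2))) fun x hx => ?_
  have h1 := hB _ (hfC _ hx)
  rw [colInner_mul_nbar] at h1
  rw [mem_closedBall_zero_iff, Real.norm_eq_abs, le_div_iff₀ hs]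
  calc |x| * (g 0 1 ^ 2 + g 1 1 ^ 2) = |x * (g 0 1 ^ 2 + g 1 1 ^ 2)| := by
        rw [abs_mul, abs_of_pos hs]
    _ = |(colInner g + x * (g 0 1 ^ 2 + g 1 1 ^ 2)) - colInner g| := by rw [add_sub_cancel_left]
    _ ≤ B + |colInner g| := (abs_sub _ _).trans (by linarith)

/-- The pairing of `u_z` with `x ↦ f (g n̄_x)`. -/
def smoothConv (z : ℂ) (f : G → ℂ) (g : G) : ℂ := kernelConv z (fun x => f (g * nbar x)) 0

theorem hasKernelIntegral_smoothConv {z : ℂ} (hz : z.re = 0) {f : IndFun ε lam}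
    (hf : IsSmoothCompact f) (g : G) :
    HasKernelIntegral z (fun x => f (g * nbar x)) (smoothConv z f g) := by
  have := hasKernelIntegral_kernelConv (hf.1.contDiff_fiber g) (hf.hasCompactSupport_fiber g) hz 0
  simp only [add_zero] at this
  exact this

/-- Both sides are the value of `u_z` on the same translated function. -/
theorem smoothConv_mul_nbar {z : ℂ} (hz : z.re = 0) {f : IndFun ε lam}
    (hf : IsSmoothCompact f) (g : G) (y : ℝ) :
    smoothConv z f (g * nbar y) = kernelConv z (fun x => f (g * nbar x)) y := by
  refine hasKernelIntegral_unique hz (hasKernelIntegral_smoothConv hz hf _) ?_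
  have := hasKernelIntegral_kernelConv (hf.1.contDiff_fiber g) (hf.hasCompactSupport_fiber g) hz y
  simpa only [mul_assoc, ← nbar_add, add_comm y] using this

/-- A pointwise limit along `w = z + 1/(n+1)` of parameter integrals, which are measurable in `g`.
-/
theorem measurable_smoothConv {z : ℂ} (hz : z.re = 0) {f : IndFun ε lam}
    (hf : IsSmoothCompact f) : Measurable (smoothConv z f) := by
  have hw : Tendsto (fun n : ℕ => z + ((1 / ((n : ℝ) + 1) : ℝ) : ℂ)) atTop
      (𝓝[{w : ℂ | 0 < w.re}] z) := by
    refine tendsto_nhdsWithin_iff.2 ⟨?_, Eventually.of_forall fun n => ?_⟩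
    · have h := (Complex.continuous_ofReal.tendsto 0).comp
        (tendsto_one_div_add_atTop_nhds_zero_nat (𝕜 := ℝ))
      simpa using h.const_add z
    · have : (0 : ℝ) < 1 / ((n : ℝ) + 1) := by positivity
      change 0 < (z + ((1 / ((n : ℝ) + 1) : ℝ) : ℂ)).re
      rwa [Complex.add_re, hz, zero_add, Complex.ofReal_re]
  refine measurable_of_tendsto_metrizable (fun n => ?_)
    (tendsto_pi_nhds.2 fun g => (hasKernelIntegral_smoothConv hz hf g).comp hw)
  refine Measurable.const_mul ?_ _
  have h2 : Measurable fun q : G × ℝ => f (q.1 * nbar q.2) :=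
    f.2.1.comp (continuous_fst.mul (continuous_nbar.comp continuous_snd)).measurable
  have h3 : Measurable fun q : G × ℝ =>
      ((|q.2| : ℝ) : ℂ) ^ ((z + ((1 / ((n : ℝ) + 1) : ℝ) : ℂ)) / 2 - 1) := by fun_prop
  exact ((h3.mul h2).stronglyMeasurable.integral_prod_right' (ν := volume)).measurable

theorem smoothConv_fiber_ae_eq {z : ℂ} (hz : z.re = 0) {f : IndFun ε lam}
    (hf : IsSmoothCompact f) (g : G) :
    (fun y => smoothConv z f (g * nbar y)) =ᵐ[volume] kernelOp z hz
      (memLp_of_contDiff (hf.1.contDiff_fiber g) (hf.hasCompactSupport_fiber g)).toLp := by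
  simp only [smoothConv_mul_nbar hz hf]
  exact kernelConv_ae_eq (hf.1.contDiff_fiber g) (hf.hasCompactSupport_fiber g) hz

theorem isKernelConvolution_smoothConv {z : ℂ} (hz : z.re = 0) {f : IndFun ε lam}
    (hf : IsSmoothCompact f) (g : G) :
    IsKernelConvolution z (fun y => f (g * nbar y)) (fun y => smoothConv z f (g * nbar y)) := by
  have h := smoothConv_fiber_ae_eq hz hf g
  have h2 : MemLp (fun y => smoothConv z f (g * nbar y)) 2 := (Lp.memLp _).ae_eq h.symm
  rw [isKernelConvolution_iff hz
    (memLp_of_contDiff (hf.1.contDiff_fiber g) (hf.hasCompactSupport_fiber g)) h2]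
  exact Lp.ext (h.symm.trans h2.coeFn_toLp.symm)

theorem fiberEnergy_smoothConv {z : ℂ} (hz : z.re = 0) {f : IndFun ε lam}
    (hf : IsSmoothCompact f) (g : G) :
    fiberEnergy (smoothConv z f) g = fiberEnergy f g :=
  (isKernelConvolution_smoothConv hz hf g).fiberEnergy_eq hz
    (memLp_of_contDiff (hf.1.contDiff_fiber g) (hf.hasCompactSupport_fiber g))
    ((Lp.memLp _).ae_eq (smoothConv_fiber_ae_eq hz hf g).symm)

/-- Here the pairing is defined at every `g`, so homogeneity with `c = t⁻²` gives the law directly: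
`|t|^(-λ) |t|^(λ-ν) = |t|^(-ν)`. -/
theorem isEquivariant_smoothConv {f : IndFun ε lam} (hf : IsSmoothCompact f) :
    IsEquivariant ε nu (smoothConv ((lam : ℂ) - nu) f) := by
  have hz := re_sub_eq_zero lam nu
  intro g h hh
  have h0 := mem_diag_ne hh
  have ha : ((|h 0 0| : ℝ) : ℂ) ≠ 0 := by exact_mod_cast (abs_pos.2 h0).ne'
  refine hasKernelIntegral_unique hz (hasKernelIntegral_smoothConv hz hf _) ?_
  have key := ((hasKernelIntegral_smoothConv hz hf g).comp_mul
    (inv_ne_zero (pow_ne_zero 2 h0))).const_mul (signedPow ε lam (h 0 0))⁻¹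
  simp only [← f.2.2.1.fiber_mul_diag g hh] at key
  convert key using 1
  rw [← mul_assoc]
  congr 1
  have e1 : |(h 0 0 ^ 2)⁻¹| = |h 0 0|⁻¹ * |h 0 0|⁻¹ := by
    rw [abs_inv, abs_pow, sq, mul_inv]
  have harg : ((|h 0 0| : ℝ) : ℂ).arg ≠ Real.pi := by
    rw [Complex.arg_ofReal_of_nonneg (abs_nonneg _)]
    exact Real.pi_pos.ne
  rw [e1, Complex.ofReal_mul, Complex.mul_cpow_ofReal_nonneg (by positivity) (by positivity),
    Complex.ofReal_inv, Complex.inv_cpow _ _ harg, ← Complex.cpow_neg, ← Complex.cpow_add _ _ ha,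
    signedPow, signedPow, mul_inv, mul_inv, ← Complex.cpow_neg, ← Complex.cpow_neg, mul_assoc,
    ← Complex.cpow_add _ _ ha]
  congr 2
  ring

end smooth

end SL2

end

/-! ### The unitary intertwining operator -/

theorem mainTheorem4 (ε : ZMod 2) (lam nu : SL2.ImaginaryAxis) :
    ∃ U : SL2.Ind ε lam ≃ₗᵢ[ℂ] SL2.Ind ε nu,
      (∀ (f : SL2.IndFun ε lam) (F : SL2.IndFun ε nu),
        U (SeparationQuotient.mk f) = SeparationQuotient.mk F ↔
          SL2.IsConvolutionAlongNbar f F) ∧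
      (∀ f : SL2.IndFun ε lam, SL2.IsSmoothCompact f →
        ∃ F : SL2.IndFun ε nu, U (SeparationQuotient.mk f) = SeparationQuotient.mk F ∧
          ∀ g : SL2.G, SL2.HasKernelIntegral ((lam : ℂ) - nu)
            (fun x => f (g * SL2.nbar x)) (F g)) ∧
      (∀ (g : SL2.G) (v : SL2.Ind ε lam),
        U (SL2.leftRegular ε lam g v) = SL2.leftRegular ε nu g (U v)) := by
  have hz := SL2.re_sub_eq_zero lam nu
  have hU := SL2.intertwinerIsometry_mk_eq_iff (ε := ε) (lam := lam) (nu := nu)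
  refine ⟨LinearIsometryEquiv.ofSurjective (SL2.intertwinerIsometry ε lam nu)
    SL2.intertwinerIsometry_surjective, hU, fun f hf => ?_, fun g v => ?_⟩
  -- The pointwise pairing is itself a fibrewise convolution of `f`, so the characterization of `U`
  -- makes it a representative of the image.
  · refine ⟨⟨SL2.smoothConv ((lam : ℂ) - nu) f, SL2.mem_indSubmodule_of_fiberEnergy_eq f
      (SL2.measurable_smoothConv hz hf) (SL2.isEquivariant_smoothConv hf)
      fun g _ => SL2.fiberEnergy_smoothConv hz hf g⟩, ?_,
      fun g => SL2.hasKernelIntegral_smoothConv hz hf g⟩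
    exact (hU _ _).2 (SL2.isConvolutionAlongNbar_of_forall fun g _ =>
      SL2.isKernelConvolution_smoothConv hz hf g)
  · obtain ⟨f, rfl⟩ := SeparationQuotient.surjective_mk v
    exact (hU _ _).2 ((SL2.chooseConv_spec nu f).leftTranslate g)
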